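/- Let $K$ be a field of characteristic $0$, let $n\ge 0$, and let $G$ be a finite simple graph with vertex set $[n]=\{1,\dots,n\}$. Let $\mathbf z=(z_1,z_2,\dots)$, let $\mathrm{Sym}_K(\mathbf z)$ be the algebra of symmetric functions (formal power series in $\mathbf z$ over $K$ of bounded degree that are invariant under permutations of the variables), and let $e_k,h_k,p_k$ be the elementary, complete and power-sum symmetric functions; for an integer partition $\lambda=(\lambda_1,\dots,\lambda_r)$ put $p_\lambda=p_{\lambda_1}\cdots p_{\lambda_r}$ (with $p_\emptyset=1$) and $\ell(\lambda)=r$. Let $\omega$ be the duality mapping, that is, the $K$-algebra homomorphism $\mathrm{Sym}_K(\mathbf z)\to \mathrm{Sym}_K(\mathbf z)$ with $\omega(e_k)=h_k$ for all $k\ge 1$. The chromatic symmetric function of $G$ is $$X_G(\mathbf z)=\sum_{f}\ \prod_{v\in[n]}z_{f(v)},$$ where $f$ runs over the proper colorings $f:[n]\to\{1,2,3,\dots\}$ of $G$. Let $\mathcal A$ be the set of acyclic orientations of $G$. For $\gamma\in\mathcal A$ and $i\in[n]$, let $R_i$ be the set of vertices reachable from $i$ by a directed path of $\gamma$ (with $i\in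 R_i$). Define $S_1,S_2,\dots$ recursively: if $\bigcup_{i<k}S_i=[n]$, then $S_k=\emptyset$; otherwise $S_k=R_m\setminus\bigcup_{i<k}S_i$ with $m=\min\bigl([n]\setminus\bigcup_{i<k}S_i\bigr)$. The nonempty sets $S_k$ are the source-components of $\gamma$, and $\lambda(\gamma)$ is the partition of $n$ formed by their sizes, so that $\ell(\lambda(\gamma))$ is the number of source-components of $\gamma$. Then $$X_G(\mathbf z)=(-1)^n\sum_{\gamma\in\mathcal A}(-1)^{\ell(\lambda(\gamma))}\,p_{\lambda(\gamma)}(\mathbf z),$$ and, equivalently, $$\omega(X_G)(\mathbf z)=\sum_{\gamma\in\mathcal A}p_{\lambda(\gamma)}(\mathbf z).$$ -/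

import Mathlib

noncomputable section

namespace ChromSym

/-! ### Symmetric functions in the variables `z_1, z_2, …` -/

section SymmetricFunctions

open MvPowerSeries

/-- A formal power series in variables indexed by the positive integers is a symmetric function if
it is invariant under all permutations of the variables and of bounded degree. -/
def IsSymmFun {K : Type*} [CommRing K] (f : MvPowerSeries ℕ+ K) : Prop :=
  (∀ (σ : Equiv.Perm ℕ+) (d : ℕ+ →₀ ℕ), coeff (d.mapDomain σ) f = coeff d f) ∧
    ∃ N : ℕ, ∀ d : ℕ+ →₀ ℕ, coeff d f ≠ 0 → d.degree ≤ N

lemma perm_invariant_iff {K : Type*} [CommRing K] (f : MvPowerSeries ℕ+ K) :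
    (∀ (σ : Equiv.Perm ℕ+) (d : ℕ+ →₀ ℕ), coeff (d.mapDomain σ) f = coeff d f) ↔
      ∀ σ : Equiv.Perm ℕ+, killCompl σ.toEmbedding f = f := by
  refine forall_congr' fun σ => ?_
  rw [MvPowerSeries.ext_iff]
  refine forall_congr' fun d => ?_
  rw [coeff_killCompl, Finsupp.embDomain_eq_mapDomain]
  rfl

/-- The `K`-algebra of symmetric functions in `z_1, z_2, …`. -/
def SymFun (K : Type*) [CommRing K] : Subalgebra K (MvPowerSeries ℕ+ K) where
  carrier := {f | IsSymmFun f}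
  mul_mem' := by
    rintro f g ⟨hf, N, hN⟩ ⟨hg, M, hM⟩
    refine ⟨?_, N + M, fun d hd => ?_⟩
    · rw [perm_invariant_iff] at *
      intro σ
      rw [map_mul, hf, hg]
    · classical
      rw [coeff_mul] at hd
      obtain ⟨⟨a, b⟩, hab, h⟩ := Finset.exists_ne_zero_of_sum_ne_zero hd
      obtain rfl : a + b = d := by simpa using hab
      rw [map_add]
      exact add_le_add (hN _ (left_ne_zero_of_mul h)) (hM _ (right_ne_zero_of_mul h))
  add_mem' := by
    rintro f g ⟨hf, N, hN⟩ ⟨hg, M, hM⟩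
    refine ⟨?_, N + M, fun d hd => ?_⟩
    · rw [perm_invariant_iff] at *
      intro σ
      rw [map_add, hf, hg]
    · rw [map_add] at hd
      by_cases h : coeff d f = 0
      · have := hM d (by simpa [h] using hd)
        omega
      · have := hN d h
        omega
  algebraMap_mem' := by
    intro r
    refine ⟨?_, 0, fun d hd => ?_⟩
    · rw [perm_invariant_iff]
      intro σ
      exact AlgHom.commutes _ r
    · classical
      rw [MvPowerSeries.algebraMap_apply, coeff_C] at hd
      by_cases h : d = 0
      · simp [h]
      · simp [h] at hd

lemma mapDomain_le_one_iff (σ : Equiv.Perm ℕ+) (d : ℕ+ →₀ ℕ) :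
    (∀ i, d.mapDomain σ i ≤ 1) ↔ ∀ i, d i ≤ 1 := by
  rw [← σ.forall_congr_right]
  simp [Finsupp.mapDomain_apply σ.injective]

lemma degree_mapDomain_perm (σ : Equiv.Perm ℕ+) (d : ℕ+ →₀ ℕ) :
    (d.mapDomain σ).degree = d.degree := by
  simp [Finsupp.degree_mapDomain]

open Classical in
/-- The elementary symmetric function `e_k`, the sum of all squarefree monomials of degree `k`. -/
def elemSym (K : Type*) [CommRing K] (k : ℕ) : SymFun K :=
  ⟨fun d => if d.degree = k ∧ ∀ i, d i ≤ 1 then 1 else 0, by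
    refine ⟨fun σ d => ?_, k, fun d hd => ?_⟩
    · change ite _ _ _ = ite _ _ _
      rw [degree_mapDomain_perm, mapDomain_le_one_iff]
    · by_contra h
      exact hd (if_neg fun h' => h h'.1.le)⟩

open Classical in
/-- The complete symmetric function `h_k`, the sum of all monomials of degree `k`. -/
def completeSym (K : Type*) [CommRing K] (k : ℕ) : SymFun K :=
  ⟨fun d => if d.degree = k then 1 else 0, by
    refine ⟨fun σ d => ?_, k, fun d hd => ?_⟩
    · change ite _ _ _ = ite _ _ _
      rw [degree_mapDomain_perm]
    · by_contra h
      exact hd (if_neg fun h' => h h'.le)⟩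

open Classical in
/-- The power-sum symmetric function `p_k = ∑ i, z_i ^ k` for `k ≥ 1`; also `p_0 = 1`. -/
def powerSum (K : Type*) [CommRing K] (k : ℕ) : SymFun K :=
  ⟨fun d => if ∃ i : ℕ+, d = Finsupp.single i k then 1 else 0, by
    refine ⟨fun σ d => ?_, k, fun d hd => ?_⟩
    · change ite _ _ _ = ite _ _ _
      congr 1
      rw [← σ.exists_congr_right, eq_iff_iff]
      refine exists_congr fun i => ?_
      rw [← Finsupp.mapDomain_single, (Finsupp.mapDomain_injective σ.injective).eq_iff]
    · by_contra h
      refine hd (if_neg ?_)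
      rintro ⟨i, rfl⟩
      simp at h⟩

/-- `p_μ = p_{μ_1} p_{μ_2} ⋯` for an integer partition `μ`. -/
def powerSumPart (K : Type*) [CommRing K] {n : ℕ} (μ : n.Partition) : SymFun K :=
  (μ.parts.map (powerSum K)).prod

/-! ### The duality map: the `e_k`, `k ≥ 1`, freely generate the symmetric functions -/

/-- The algebra map from a polynomial ring that sends its `i`-th variable to `e_{i+1}`. -/
def eHom (K : Type*) [CommRing K] : MvPolynomial ℕ K →ₐ[K] SymFun K :=
  MvPolynomial.aeval fun i => elemSym K (i + 1)

/-- The first `m` positive integers. -/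
def firstVars (m : ℕ) : Fin m ↪ ℕ+ :=
  ⟨fun i => Nat.succPNat i, fun _ _ hij => Fin.ext (Nat.succPNat_injective hij)⟩

/-- Setting the variables `z_i`, `i > m`, to zero. -/
def restrict (K : Type*) [CommRing K] (m : ℕ) : SymFun K →ₐ[K] MvPowerSeries (Fin m) K :=
  (killCompl (firstVars m)).comp (SymFun K).val

lemma coeff_esymm {K : Type*} [CommRing K] (m k : ℕ) (d : Fin m →₀ ℕ) [Decidable (∀ i, d i ≤ 1)] :
    MvPolynomial.coeff d (MvPolynomial.esymm (Fin m) K k) =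
      if d.degree = k ∧ ∀ i, d i ≤ 1 then 1 else 0 := by
  classical
  have key : ∀ t : Finset (Fin m), (∑ i ∈ t, Finsupp.single i 1 = d) ↔
      (t = d.support ∧ ∀ i, d i ≤ 1) := by
    intro t
    have hval : ∀ i, (∑ i ∈ t, Finsupp.single i 1 : Fin m →₀ ℕ) i = if i ∈ t then 1 else 0 := by
      intro i
      simp [Finsupp.finsetSum_apply, Finsupp.single_apply]
    constructor
    · rintro rfl
      refine ⟨?_, fun i => ?_⟩
      · ext i
        rw [Finsupp.mem_support_iff, hval]
        simp
      · rw [hval]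
        split_ifs <;> simp
    · rintro ⟨rfl, hd⟩
      ext i
      rw [hval]
      have := hd i
      by_cases hi : d i = 0
      · simp [hi]
      · simp [hi]
        omega
  have hdeg : (∀ i, d i ≤ 1) → d.degree = d.support.card := by
    intro hd
    rw [Finsupp.degree_apply, Finset.card_eq_sum_ones]
    refine Finset.sum_congr rfl fun i hi => ?_
    have := hd i
    have := Finsupp.mem_support_iff.1 hi
    omega
  rw [MvPolynomial.esymm_eq_sum_monomial, MvPolynomial.coeff_sum]
  simp_rw [MvPolynomial.coeff_monomial, key]
  by_cases hd : ∀ i, d i ≤ 1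
  · simp [hd, hdeg hd, Finset.mem_powersetCard]
  · simp [hd]

lemma restrict_elemSym {K : Type*} [CommRing K] (m k : ℕ) :
    restrict K m (elemSym K k) = (MvPolynomial.esymm (Fin m) K k : MvPolynomial (Fin m) K) := by
  classical
  ext d
  rw [MvPolynomial.coeff_coe, coeff_esymm]
  change ite _ _ _ = _
  congr 1
  rw [Finsupp.embDomain_eq_mapDomain, Finsupp.degree_mapDomain, eq_iff_iff]
  refine and_congr_right fun _ => ⟨fun H i => ?_, fun H i => ?_⟩
  · simpa [Finsupp.mapDomain_apply (firstVars m).injective] using H (firstVars m i)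
  · by_cases hi : i ∈ Set.range (firstVars m)
    · obtain ⟨j, rfl⟩ := hi
      simpa [Finsupp.mapDomain_apply (firstVars m).injective] using H j
    · rw [Finsupp.mapDomain_of_notMem_range _ _ hi]
      exact zero_le_one

/-- On polynomials in the first `m` variables, `eHom` restricts to the corresponding map for
symmetric polynomials in `m` variables. -/
lemma restrict_eHom_rename {K : Type*} [CommRing K] (m : ℕ) (P : MvPolynomial (Fin m) K) :
    restrict K m (eHom K (P.rename Fin.val)) =
      ((MvPolynomial.esymmAlgHom (Fin m) K m P).val : MvPolynomial (Fin m) K) := by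
  have : (((restrict K m).comp (eHom K)).comp (MvPolynomial.rename Fin.val)) =
      (MvPolynomial.coeToMvPowerSeries.algHom K).comp
        ((MvPolynomial.symmetricSubalgebra (Fin m) K).val.comp
          (MvPolynomial.esymmAlgHom (Fin m) K m)) := by
    apply MvPolynomial.algHom_ext
    intro i
    simp [eHom, MvPolynomial.esymmAlgHom, restrict_elemSym]
  simpa using DFunLike.congr_fun this P

lemma eHom_injective (K : Type*) [CommRing K] : Function.Injective (eHom K) := by
  rw [injective_iff_map_eq_zero]
  intro P hP
  obtain ⟨m, hm⟩ : ∃ m, (P.vars : Set ℕ) ⊆ Set.range (Fin.val : Fin m → ℕ) := by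
    refine ⟨P.vars.sup id + 1, fun i hi => ⟨⟨i, Nat.lt_succ_of_le (Finset.le_sup (f := id) hi)⟩, rfl⟩⟩
  obtain ⟨Q, rfl⟩ := MvPolynomial.exists_rename_eq_of_vars_subset_range P Fin.val
    Fin.val_injective hm
  have h1 := restrict_eHom_rename m Q
  rw [hP, map_zero, eq_comm, MvPolynomial.coe_eq_zero_iff] at h1
  have h2 : MvPolynomial.esymmAlgHom (Fin m) K m Q = 0 := Subtype.ext h1
  rw [(injective_iff_map_eq_zero _).1 (MvPolynomial.esymmAlgHom_fin_injective K le_rfl) Q h2,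
    map_zero]

/-- Symmetric functions with the same restriction to `m` variables agree in degrees `≤ m`. -/
lemma coeff_eq_of_restrict_eq {K : Type*} [CommRing K] {m : ℕ} {f g : SymFun K}
    (hfg : restrict K m f = restrict K m g) {d : ℕ+ →₀ ℕ} (hd : d.degree ≤ m) :
    coeff d f.1 = coeff d g.1 := by
  classical
  have hcard : d.support.card ≤ m := by
    refine le_trans ?_ hd
    rw [Finsupp.degree_apply, Finset.card_eq_sum_ones]
    exact Finset.sum_le_sum fun i hi => Nat.one_le_iff_ne_zero.2 (Finsupp.mem_support_iff.1 hi)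
  let x : Fin d.support.card ↪ ℕ+ :=
    d.support.equivFin.symm.toEmbedding.trans (Function.Embedding.subtype _)
  obtain ⟨σ, hσ⟩ := (Equiv.Perm.isMultiplyPretransitive ℕ+ d.support.card).exists_smul_eq
    x (firstVars _)
  have hrange : d.mapDomain σ ∈ Set.range (Finsupp.embDomain (firstVars m)) := by
    rw [Finsupp.mem_range_embDomain_iff]
    intro i hi
    obtain ⟨j, hj, rfl⟩ := Finset.mem_image.1 (Finsupp.mapDomain_support hi)
    have h1 := DFunLike.congr_fun hσ (d.support.equivFin ⟨j, hj⟩)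
    have h2 : σ j = firstVars d.support.card (d.support.equivFin ⟨j, hj⟩) := by
      rw [← h1]
      simp [x]
    rw [h2]
    exact ⟨Fin.castLE hcard _, rfl⟩
  obtain ⟨d', hd'⟩ := hrange
  rw [← f.2.1 σ d, ← g.2.1 σ d, ← hd']
  exact congrArg (fun F => coeff d' F) hfg

lemma degree_of_coeff_eHom_monomial {K : Type*} [CommRing K] (t : ℕ →₀ ℕ) (r : K)
    (d : ℕ+ →₀ ℕ) (hd : coeff d (eHom K (MvPolynomial.monomial t r)).1 ≠ 0) :
    d.degree = Finsupp.weight (fun i => i + 1) t := by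
  classical
  have h0 : ∀ (r : K) (d : ℕ+ →₀ ℕ),
      coeff d (eHom K (MvPolynomial.monomial 0 r)).1 ≠ 0 → d.degree = 0 := by
    intro r d hd
    have h1 : (eHom K (MvPolynomial.monomial 0 r)).1 = C r :=
      congrArg Subtype.val ((eHom K).commutes r)
    rw [h1, coeff_C] at hd
    by_cases h : d = 0
    · simp [h]
    · simp [h] at hd
  have hX : ∀ (i : ℕ) (d : ℕ+ →₀ ℕ),
      coeff d (eHom K (MvPolynomial.X i)).1 ≠ 0 → d.degree = i + 1 := by
    intro i d hd
    by_contra h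
    refine hd ?_
    rw [eHom, MvPolynomial.aeval_X]
    exact if_neg fun h' => h h'.1
  have hmul : ∀ (f g : SymFun K) (a b : ℕ) (_ : ∀ d, coeff d f.1 ≠ 0 → d.degree = a)
      (_ : ∀ d, coeff d g.1 ≠ 0 → d.degree = b) (d : ℕ+ →₀ ℕ),
      coeff d (f * g).1 ≠ 0 → d.degree = a + b := by
    intro f g a b hf hg d hd
    rw [Subalgebra.coe_mul, coeff_mul] at hd
    obtain ⟨⟨u, v⟩, huv, h⟩ := Finset.exists_ne_zero_of_sum_ne_zero hd
    obtain rfl : u + v = d := by simpa using huv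
    rw [map_add, hf u (left_ne_zero_of_mul h), hg v (right_ne_zero_of_mul h)]
  induction t using Finsupp.induction_linear generalizing r d with
  | zero => rw [map_zero]; exact h0 r d hd
  | add s t hs ht =>
    rw [← mul_one r, ← MvPolynomial.monomial_mul, map_mul] at hd
    rw [map_add]
    exact hmul _ _ _ _ (hs r) (ht 1) d hd
  | single i k =>
    induction k generalizing r d with
    | zero =>
      rw [Finsupp.single_zero] at hd ⊢
      rw [map_zero]
      exact h0 r d hd
    | succ k ih =>
      rw [← mul_one r, Finsupp.single_add, ← MvPolynomial.monomial_mul, map_mul] at hd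
      rw [hmul _ _ _ _ (ih r) (hX i) d hd, Finsupp.weight_single, Finsupp.weight_single]
      simp only [smul_eq_mul]
      ring

lemma eHom_surjective (K : Type*) [CommRing K] : Function.Surjective (eHom K) := by
  classical
  intro f
  obtain ⟨N, hN⟩ := f.2.2
  set q : MvPolynomial (Fin N) K := truncTotal (N + 1) (restrict K N f) with hq
  have hqf : (q : MvPowerSeries (Fin N) K) = restrict K N f := by
    ext d
    rw [MvPolynomial.coeff_coe, hq, coeff_truncTotal_eq_ite]
    split_ifs with hd
    · rfl
    · by_contra h
      have := hN (d.embDomain (firstVars N)) fun h' => h h'.symm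
      rw [Finsupp.embDomain_eq_mapDomain, Finsupp.degree_mapDomain] at this
      omega
  have hsymm : q.IsSymmetric := by
    intro τ
    ext d
    obtain ⟨d, rfl⟩ : ∃ d', d = Finsupp.mapDomain τ d' :=
      ⟨d.mapDomain τ.symm, by rw [← Finsupp.mapDomain_comp]; simp⟩
    rw [MvPolynomial.coeff_rename_mapDomain _ τ.injective, ← MvPolynomial.coeff_coe,
      ← MvPolynomial.coeff_coe, hqf]
    change coeff (Finsupp.embDomain _ _) f.1 = coeff (Finsupp.embDomain _ _) f.1
    rw [← f.2.1 (τ.viaEmbedding (firstVars N)) (Finsupp.embDomain _ d)]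
    congr 2
    rw [Finsupp.embDomain_eq_mapDomain, Finsupp.embDomain_eq_mapDomain, ← Finsupp.mapDomain_comp,
      ← Finsupp.mapDomain_comp]
    congr 1
    ext i
    simp [Equiv.Perm.viaEmbedding_apply]
  obtain ⟨P, hP⟩ := (MvPolynomial.esymmAlgHom_fin_bijective K N).2 ⟨q, hsymm⟩
  have hres : restrict K N (eHom K (P.rename Fin.val)) = restrict K N f := by
    rw [restrict_eHom_rename, hP, hqf]
  set R := P.rename Fin.val
  refine ⟨∑ t ∈ R.support with Finsupp.weight (fun i => i + 1) t ≤ N,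
    MvPolynomial.monomial t (R.coeff t), Subtype.ext ?_⟩
  ext d
  have hsum : ∀ s : Finset (ℕ →₀ ℕ), coeff d (eHom K (∑ t ∈ s,
      MvPolynomial.monomial t (R.coeff t))).1 =
      ∑ t ∈ s, coeff d (eHom K (MvPolynomial.monomial t (R.coeff t))).1 := by
    intro s
    rw [map_sum, AddSubmonoidClass.coe_finsetSum, map_sum]
  rw [hsum, Finset.sum_filter]
  by_cases hd : d.degree ≤ N
  · rw [← coeff_eq_of_restrict_eq hres hd, R.as_sum, hsum, ← R.as_sum]
    refine Finset.sum_congr rfl fun t _ => ?_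
    split_ifs with ht
    · rfl
    · by_contra h
      exact ht ((degree_of_coeff_eHom_monomial t _ d (Ne.symm h)).symm.trans_le hd)
  · rw [show coeff d f.1 = 0 from by_contra fun h => hd (hN d h)]
    refine Finset.sum_eq_zero fun t _ => ?_
    split_ifs with ht
    · by_contra h
      exact hd ((degree_of_coeff_eHom_monomial t _ d h).trans_le ht)
    · rfl

/-- The fundamental theorem of symmetric functions. -/
def eEquiv (K : Type*) [CommRing K] : MvPolynomial ℕ K ≃ₐ[K] SymFun K :=
  AlgEquiv.ofBijective (eHom K) ⟨eHom_injective K, eHom_surjective K⟩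

/-- The duality map `ω`, the algebra endomorphism with `ω e_k = h_k`. -/
def omega (K : Type*) [CommRing K] : SymFun K →ₐ[K] SymFun K :=
  (MvPolynomial.aeval fun i => completeSym K (i + 1)).comp (eEquiv K).symm.toAlgHom

/-- `ω` is the unique algebra endomorphism with `ω e_k = h_k` for all `k ≥ 1`. -/
lemma eq_omega_iff {K : Type*} [CommRing K] (φ : SymFun K →ₐ[K] SymFun K) :
    φ = omega K ↔ ∀ k : ℕ, 1 ≤ k → φ (elemSym K k) = completeSym K k := by
  have he : ∀ i, eEquiv K (MvPolynomial.X i) = elemSym K (i + 1) := by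
    intro i
    simp [eEquiv, eHom]
  have hω : ∀ i, omega K (elemSym K (i + 1)) = completeSym K (i + 1) := by
    intro i
    simp [omega, ← he]
  constructor
  · rintro rfl (_ | k) hk
    · omega
    · exact hω k
  · intro hφ
    have : φ.comp (eEquiv K).toAlgHom = (omega K).comp (eEquiv K).toAlgHom := by
      apply MvPolynomial.algHom_ext
      intro i
      simp [he, hω, hφ (i + 1) (by omega)]
    ext1 f
    simpa using DFunLike.congr_fun this ((eEquiv K).symm f)

end SymmetricFunctions

/-! ### The chromatic symmetric function -/

section ChromaticSymmetricFunction

open MvPowerSeries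

lemma card_colorings_mapDomain {V : Type*} [Fintype V] (G : SimpleGraph V) (σ : Equiv.Perm ℕ+)
    (d : ℕ+ →₀ ℕ) :
    Nat.card {f : G.Coloring ℕ+ // ∑ v, Finsupp.single (f v) 1 = d.mapDomain σ} =
      Nat.card {f : G.Coloring ℕ+ // ∑ v, Finsupp.single (f v) 1 = d} := by
  have key : ∀ (τ : Equiv.Perm ℕ+) (f : V → ℕ+),
      (∑ v, Finsupp.single (τ (f v)) 1 : ℕ+ →₀ ℕ) =
        (∑ v, Finsupp.single (f v) 1 : ℕ+ →₀ ℕ).mapDomain τ := by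
    intro τ f
    rw [Finsupp.mapDomain_finsetSum]
    simp [Finsupp.mapDomain_single]
  have hc : ∀ (τ : Equiv.Perm ℕ+) (f : G.Coloring ℕ+) {v w : V}, G.Adj v w → τ (f v) ≠ τ (f w) :=
    fun τ f _ _ h => τ.injective.ne (f.valid h)
  refine Nat.card_congr ⟨fun f => ⟨SimpleGraph.Coloring.mk (fun v => σ.symm (f.1 v)) (hc _ _), ?_⟩,
    fun f => ⟨SimpleGraph.Coloring.mk (fun v => σ (f.1 v)) (hc _ _), ?_⟩, ?_, ?_⟩
  · refine (key σ.symm f.1).trans ?_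
    rw [f.2, ← Finsupp.mapDomain_comp]
    simp
  · refine (key σ f.1).trans ?_
    rw [f.2]
  · intro f
    apply Subtype.ext
    apply DFunLike.ext
    intro v
    exact σ.apply_symm_apply _
  · intro f
    apply Subtype.ext
    apply DFunLike.ext
    intro v
    exact σ.symm_apply_apply _

/-- The chromatic symmetric function `X_G = ∑_f ∏_v z_{f(v)}`, the sum being over all proper
colorings `f` of `G` by positive integers: the coefficient of the monomial `z ^ d` is the (finite)
number of proper colorings `f` with `∏_v z_{f(v)} = z ^ d`. -/
def chromaticSymFun (K : Type*) [CommRing K] {V : Type*} [Fintype V] (G : SimpleGraph V) :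
    SymFun K :=
  ⟨fun d => (Nat.card {f : G.Coloring ℕ+ // ∑ v, Finsupp.single (f v) 1 = d} : K), by
    refine ⟨fun σ d => congrArg Nat.cast (card_colorings_mapDomain G σ d), Fintype.card V,
      fun d hd => ?_⟩
    have h : Nat.card {f : G.Coloring ℕ+ // ∑ v, Finsupp.single (f v) 1 = d} ≠ 0 :=
      fun h => hd ((congrArg Nat.cast h).trans Nat.cast_zero)
    obtain ⟨⟨⟨f, rfl⟩⟩, -⟩ := Nat.card_ne_zero.1 h
    simp [map_sum]⟩

end ChromaticSymmetricFunction

/-! ### Acyclic orientations and their source-components -/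

section Orientations

/-- `γ` is an orientation of `G`: every edge of `G` is replaced by exactly one of its two arcs. -/
def IsOrientation {V : Type*} (G : SimpleGraph V) (γ : Digraph V) : Prop :=
  (∀ u v, G.Adj u v ↔ γ.Adj u v ∨ γ.Adj v u) ∧ ∀ u v, γ.Adj u v → ¬ γ.Adj v u

/-- `γ` has no directed cycle: no vertex is reachable from itself by a nonempty directed path. -/
def IsAcyclic {V : Type*} (γ : Digraph V) : Prop :=
  ∀ v, ¬ Relation.TransGen γ.Adj v v

open Classical in
/-- The set of acyclic orientations of `G`. -/
def acyclicOrientations {V : Type*} [Fintype V] (G : SimpleGraph V) : Finset (Digraph V) :=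
  {γ | IsOrientation G γ ∧ IsAcyclic γ}

open Classical in
/-- The set `R_i` of vertices reachable from `i` by a directed path (including `i` itself). -/
def reachable {n : ℕ} (γ : Digraph (Fin n)) (i : Fin n) : Finset (Fin n) :=
  {j | Relation.ReflTransGen γ.Adj i j}

/-- Given the union `U` of the sets already constructed, the next set is `R_m \ U`, where `m` is
the smallest vertex outside `U`; it is empty if `U` contains all vertices. -/
def nextComponent {n : ℕ} (γ : Digraph (Fin n)) (U : Finset (Fin n)) : Finset (Fin n) :=
  if hU : Uᶜ.Nonempty then reachable γ (Uᶜ.min' hU) \ U else ∅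

/-- The union of the first `k` sets `S_0, …, S_{k-1}`. -/
def covered {n : ℕ} (γ : Digraph (Fin n)) : ℕ → Finset (Fin n)
  | 0 => ∅
  | k + 1 => covered γ k ∪ nextComponent γ (covered γ k)

/-- The sets `S_0, S_1, …`; the nonempty ones are the source-components of `γ`. -/
def sourceComponent {n : ℕ} (γ : Digraph (Fin n)) (k : ℕ) : Finset (Fin n) :=
  nextComponent γ (covered γ k)

lemma card_covered {n : ℕ} (γ : Digraph (Fin n)) (k : ℕ) :
    (covered γ k).card = ((Multiset.range k).map fun i => (sourceComponent γ i).card).sum := by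
  induction k with
  | zero => simp [covered]
  | succ k ih =>
    rw [covered, Finset.card_union_of_disjoint, ih, Multiset.range_succ, Multiset.map_cons,
      Multiset.sum_cons, add_comm, sourceComponent]
    rw [nextComponent]
    split_ifs
    · exact Finset.disjoint_sdiff
    · exact Finset.disjoint_empty_right _

lemma covered_eq_univ_of_le {n : ℕ} (γ : Digraph (Fin n)) {k : ℕ} (hk : n ≤ k) :
    covered γ k = Finset.univ := by
  classical
  have key : ∀ k, covered γ k = Finset.univ ∨ k ≤ (covered γ k).card := by
    intro k
    induction k with
    | zero => exact Or.inr (Nat.zero_le _)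
    | succ k ih =>
      rcases ih with h | h
      · left
        simp [covered, h]
      · by_cases hU : (covered γ k)ᶜ.Nonempty
        · right
          have hm : (covered γ k)ᶜ.min' hU ∉ covered γ k :=
            Finset.mem_compl.1 (Finset.min'_mem _ hU)
          refine Nat.succ_le_of_lt (lt_of_le_of_lt h (Finset.card_lt_card ?_))
          rw [Finset.ssubset_iff_of_subset (by rw [covered]; exact Finset.subset_union_left)]
          refine ⟨_, ?_, hm⟩
          rw [covered, nextComponent, dif_pos hU]
          refine Finset.mem_union_right _ (Finset.mem_sdiff.2 ⟨?_, hm⟩)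
          simp [reachable, Relation.ReflTransGen.refl]
        · left
          rw [Finset.not_nonempty_iff_eq_empty, Finset.compl_eq_empty_iff] at hU
          simp [covered, hU]
  rcases key k with h | h
  · exact h
  · refine Finset.eq_univ_of_card _ (le_antisymm (Finset.card_le_univ _) ?_)
    rw [Fintype.card_fin]
    exact hk.trans h

/-- There are at most `n` source-components. -/
lemma sourceComponent_eq_empty_of_le {n : ℕ} (γ : Digraph (Fin n)) {k : ℕ} (hk : n ≤ k) :
    sourceComponent γ k = ∅ := by
  simp [sourceComponent, nextComponent, covered_eq_univ_of_le γ hk]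

/-- The partition `λ(γ)` of `n` whose parts are the sizes of the source-components of `γ`, that is,
of the nonempty sets among `S_0, …, S_{n-1}` (`Nat.Partition.ofSums` discards zeros, and all later
sets are empty). -/
def sourcePartition {n : ℕ} (γ : Digraph (Fin n)) : n.Partition :=
  Nat.Partition.ofSums n ((Multiset.range n).map fun k => (sourceComponent γ k).card) (by
    rw [← card_covered, covered_eq_univ_of_le γ le_rfl, Finset.card_univ, Fintype.card_fin])

end Orientations

end ChromSym

end

namespace ChromSym

/-! ### Restricting and gluing acyclic orientations -/

/-! The product `p_{λ(γ)}` is the sum of the monomials of all colorings that are constant on each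
source-component of γ. After exchanging sums, the expansion follows from one identity per coloring
f: summing ∏_S (-1)^(|S|-1) [f constant on S] over all γ, with S running over the source-components,
gives 1 if f is proper and 0 otherwise (`sum_prod_colorWeight`).

This identity is proved by peeling off the first component. Let m be the least vertex of U. The
first component S contains m and no arc leaves it, so γ is glued from an acyclic orientation of S in
which m reaches everything and an arbitrary acyclic orientation of U \ S (`weightSum_succ`). By
induction, only sets S inside the color class D of m count, and what remains no longer involves f:
∑_{m ∈ S ⊆ D} r(S) i(D \ S) = -i(D), where r counts the acyclic orientations rooted at m, and i(I)
is (-1)^|I| for independent I and 0 otherwise (`sum_numRooted_mul_indepSign`).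

For this last identity, let a count acyclic orientations, let * be convolution of set functions, and
let ' and '' keep the sets containing and avoiding m. Inclusion-exclusion over sources gives a * i =
δ and a' * i'' = r'. The former splits into a' * i'' = -(a'' * i') and a'' * i'' = δ, so r' * i'' =
-i'.

Finally, Newton's identities for the e_k and the h_k give ω(p_k) = (-1)^(k-1) p_k for k ≥ 1, so ω
removes exactly the sign of each component. -/

/-- The graph on the same vertices that keeps only the edges of `G` inside `U`. -/
def graphOn {V : Type*} (G : SimpleGraph V) (U : Finset V) : SimpleGraph V where
  Adj a b := G.Adj a b ∧ a ∈ U ∧ b ∈ U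
  symm := ⟨fun _ _ h => ⟨h.1.symm, h.2.2, h.2.1⟩⟩
  loopless := ⟨fun _ h => h.1.ne rfl⟩

/-- The digraph on the same vertices that keeps only the arcs of `γ` inside `U`. -/
def digraphOn {V : Type*} (γ : Digraph V) (U : Finset V) : Digraph V where
  Adj a b := γ.Adj a b ∧ a ∈ U ∧ b ∈ U

/-- No arc of `γ` leaves `S`. -/
def IsClosedUnder {V : Type*} (γ : Digraph V) (S : Finset V) : Prop :=
  ∀ a b, γ.Adj a b → a ∈ S → b ∈ S

/-- The digraph consisting of `γ₁`, `γ₂` and all edges of `G` from `T` to `S`. -/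
def glue {V : Type*} (G : SimpleGraph V) (S T : Finset V) (γ₁ γ₂ : Digraph V) : Digraph V where
  Adj a b := γ₁.Adj a b ∨ γ₂.Adj a b ∨ (G.Adj a b ∧ a ∈ T ∧ b ∈ S)

variable {V : Type*}

lemma mem_acyclicOrientations [Fintype V] {G : SimpleGraph V} {γ : Digraph V} :
    γ ∈ acyclicOrientations G ↔ IsOrientation G γ ∧ IsAcyclic γ := by
  classical
  simp [acyclicOrientations]

lemma IsAcyclic.mono {γ δ : Digraph V} (hγ : IsAcyclic γ) (h : ∀ a b, δ.Adj a b → γ.Adj a b) :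
    IsAcyclic δ :=
  fun v hv => hγ v (Relation.TransGen.mono h _ _ hv)

lemma IsOrientation.mem_left {G : SimpleGraph V} {U : Finset V} {γ : Digraph V}
    (h : IsOrientation (graphOn G U) γ) {a b : V} (hab : γ.Adj a b) : a ∈ U :=
  ((h.1 a b).2 (Or.inl hab)).2.1

lemma IsOrientation.mem_right {G : SimpleGraph V} {U : Finset V} {γ : Digraph V}
    (h : IsOrientation (graphOn G U) γ) {a b : V} (hab : γ.Adj a b) : b ∈ U :=
  ((h.1 a b).2 (Or.inl hab)).2.2

lemma digraphOn_mem_acyclicOrientations [Fintype V] {G : SimpleGraph V} {S U : Finset V}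
    (hS : S ⊆ U) {γ : Digraph V} (hγ : γ ∈ acyclicOrientations (graphOn G U)) :
    digraphOn γ S ∈ acyclicOrientations (graphOn G S) := by
  rw [mem_acyclicOrientations] at *
  obtain ⟨⟨h1, h2⟩, h3⟩ := hγ
  refine ⟨⟨fun a b => ?_, fun a b hab hba => h2 a b hab.1 hba.1⟩, h3.mono fun a b h => h.1⟩
  have := h1 a b
  have ha := @hS a
  have hb := @hS b
  simp only [graphOn, digraphOn] at *
  tauto

/-- All new arcs run from `U \ S` into `S`, and nothing leaves `S`. A directed cycle would therefore
stay on one side and be a cycle of `γ₁` or `γ₂`. -/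
lemma glue_mem_acyclicOrientations [Fintype V] [DecidableEq V] {G : SimpleGraph V}
    {S U : Finset V} (hS : S ⊆ U) {γ₁ γ₂ : Digraph V}
    (h₁ : γ₁ ∈ acyclicOrientations (graphOn G S))
    (h₂ : γ₂ ∈ acyclicOrientations (graphOn G (U \ S))) :
    glue G S (U \ S) γ₁ γ₂ ∈ acyclicOrientations (graphOn G U) := by
  rw [mem_acyclicOrientations] at *
  obtain ⟨o₁, a₁⟩ := h₁
  obtain ⟨o₂, a₂⟩ := h₂
  have l₁ := fun a b => @IsOrientation.mem_left _ _ _ _ o₁ a b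
  have r₁ := fun a b => @IsOrientation.mem_right _ _ _ _ o₁ a b
  have l₂ := fun a b => @IsOrientation.mem_left _ _ _ _ o₂ a b
  have r₂ := fun a b => @IsOrientation.mem_right _ _ _ _ o₂ a b
  simp only [Finset.mem_sdiff] at l₂ r₂
  refine ⟨⟨fun a b => ?_, fun a b => ?_⟩, fun v hv => ?_⟩
  · have h1 := o₁.1 a b
    have h2 := o₂.1 a b
    have h9 := G.adj_comm a b
    simp only [graphOn, glue, Finset.mem_sdiff] at *
    grind
  · have h1 := o₁.2 a b
    have h2 := o₂.2 a b
    simp only [glue, Finset.mem_sdiff] at *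
    grind
  -- A path starting in `S` stays there and uses only `γ₁`; a path ending outside `S` has never met
  -- `S` and uses only `γ₂`.
  · have key : ∀ w, Relation.TransGen (glue G S (U \ S) γ₁ γ₂).Adj v w →
        (v ∈ S → w ∈ S ∧ Relation.TransGen γ₁.Adj v w) ∧
          (w ∉ S → v ∉ S ∧ Relation.TransGen γ₂.Adj v w) := by
      intro w hw
      induction hw with
      | single h =>
        rename_i w
        rcases h with h | h | h
        · exact ⟨fun _ => ⟨r₁ _ _ h, .single h⟩, fun hw => absurd (r₁ _ _ h) hw⟩
        · exact ⟨fun hv => absurd hv (l₂ _ _ h).2, fun _ => ⟨(l₂ _ _ h).2, .single h⟩⟩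
        · exact ⟨fun hv => absurd hv (Finset.mem_sdiff.1 h.2.1).2, fun hw => absurd h.2.2 hw⟩
      | tail _ h ih =>
        rename_i b c _
        rcases h with h | h | h
        · exact ⟨fun hv => ⟨r₁ _ _ h, (ih.1 hv).2.tail h⟩, fun hw => absurd (r₁ _ _ h) hw⟩
        · exact ⟨fun hv => absurd (ih.1 hv).1 (l₂ _ _ h).2,
            fun _ => ⟨(ih.2 (l₂ _ _ h).2).1, (ih.2 (l₂ _ _ h).2).2.tail h⟩⟩
        · exact ⟨fun hv => absurd (ih.1 hv).1 (Finset.mem_sdiff.1 h.2.1).2,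
            fun hw => absurd h.2.2 hw⟩
    by_cases hvS : v ∈ S
    · exact a₁ v ((key v hv).1 hvS).2
    · exact a₂ v ((key v hv).2 hvS).2

open Classical in
/-- Acyclic orientations of `G` on `U` for which no arc leaves `S` are pairs of acyclic
orientations on `S` and on `U \ S`. -/
lemma sum_closed_eq_mul [Fintype V] [DecidableEq V] {R : Type*} [CommSemiring R]
    (G : SimpleGraph V) {S U : Finset V} (hS : S ⊆ U) (φ ψ : Digraph V → R) :
    ∑ γ ∈ acyclicOrientations (graphOn G U) with IsClosedUnder γ S,
        φ (digraphOn γ S) * ψ (digraphOn γ (U \ S)) =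
      (∑ γ ∈ acyclicOrientations (graphOn G S), φ γ) *
        ∑ γ ∈ acyclicOrientations (graphOn G (U \ S)), ψ γ := by
  rw [Finset.sum_mul_sum, ← Finset.sum_product']
  refine Finset.sum_bij' (fun γ _ => (digraphOn γ S, digraphOn γ (U \ S)))
    (fun p _ => glue G S (U \ S) p.1 p.2) ?_ ?_ ?_ ?_ ?_
  · intro γ hγ
    have hγ := (Finset.mem_filter.1 hγ).1
    exact Finset.mem_product.2 ⟨digraphOn_mem_acyclicOrientations hS hγ,
      digraphOn_mem_acyclicOrientations Finset.sdiff_subset hγ⟩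
  · intro p hp
    obtain ⟨h1, h2⟩ := Finset.mem_product.1 hp
    refine Finset.mem_filter.2 ⟨glue_mem_acyclicOrientations hS h1 h2, ?_⟩
    rw [mem_acyclicOrientations] at h1 h2
    rintro a b (h | h | h) ha
    · exact h1.1.mem_right h
    · exact absurd ha (Finset.mem_sdiff.1 (h2.1.mem_left h)).2
    · exact h.2.2
  -- As no arc leaves `S`, every edge between `S` and `U \ S` points into `S`, so the two
  -- restrictions determine `γ`.
  · intro γ hγ
    obtain ⟨hγ, hc⟩ := Finset.mem_filter.1 hγ
    obtain ⟨o, -⟩ := mem_acyclicOrientations.1 hγ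
    ext a b
    have h1 := o.1 a b
    have h3 := hc a b
    have h4 := hc b a
    have h7 := @hS a
    have h8 := @hS b
    simp only [graphOn, digraphOn, glue, Finset.mem_sdiff] at *
    grind
  · intro p hp
    obtain ⟨h1, h2⟩ := Finset.mem_product.1 hp
    rw [mem_acyclicOrientations] at h1 h2
    ext a b
    all_goals
      have l₁ := @IsOrientation.mem_left _ _ _ _ h1.1 a b
      have r₁ := @IsOrientation.mem_right _ _ _ _ h1.1 a b
      have l₂ := @IsOrientation.mem_left _ _ _ _ h2.1 a b
      have r₂ := @IsOrientation.mem_right _ _ _ _ h2.1 a b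
      simp only [digraphOn, glue, Finset.mem_sdiff] at *
      grind
  · intro γ _
    rfl

/-! ### Convolution of set functions -/

/-- The convolution `U ↦ ∑_{S ⊆ U} a(S) b(U \ S)` of set functions. -/
def setConv [DecidableEq V] {R : Type*} [CommRing R] (a b : Finset V → R) (U : Finset V) : R :=
  ∑ S ∈ U.powerset, a S * b (U \ S)

section Convolution

variable [DecidableEq V] {R : Type*} [CommRing R]

lemma setConv_comm (a b : Finset V → R) : setConv a b = setConv b a := by
  funext U
  refine Finset.sum_bij' (fun S _ => U \ S) (fun S _ => U \ S) ?_ ?_ ?_ ?_ ?_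
  · intro S _
    simp
  · intro S _
    simp
  · intro S hS
    simpa using Finset.mem_powerset.1 hS
  · intro S hS
    simpa using Finset.mem_powerset.1 hS
  · intro S hS
    rw [Finset.sdiff_sdiff_eq_self (Finset.mem_powerset.1 hS), mul_comm]

lemma setConv_assoc (a b c : Finset V → R) :
    setConv (setConv a b) c = setConv a (setConv b c) := by
  funext U
  simp only [setConv, Finset.sum_mul, Finset.mul_sum]
  rw [Finset.sum_sigma', Finset.sum_sigma']
  -- Both sides sum over ordered splittings of `U` into three blocks: `W`, `S \ W`, `U \ S`.
  refine Finset.sum_bij' (fun p _ => ⟨p.2, p.1 \ p.2⟩) (fun p _ => ⟨p.1 ∪ p.2, p.1⟩) ?_ ?_ ?_ ?_ ?_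
  · rintro ⟨S, W⟩ h
    simp only [Finset.mem_sigma, Finset.mem_powerset] at *
    exact ⟨h.2.trans h.1, Finset.sdiff_subset_sdiff h.1 le_rfl⟩
  · rintro ⟨W, J⟩ h
    simp only [Finset.mem_sigma, Finset.mem_powerset] at *
    exact ⟨Finset.union_subset h.1 (h.2.trans Finset.sdiff_subset), Finset.subset_union_left⟩
  · rintro ⟨S, W⟩ h
    simp only [Finset.mem_sigma, Finset.mem_powerset] at *
    simp [Finset.union_eq_right.2 h.2]
  · rintro ⟨W, J⟩ h
    simp only [Finset.mem_sigma, Finset.mem_powerset] at *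
    rw [Finset.union_sdiff_cancel_left]
    exact Finset.disjoint_of_subset_right h.2 Finset.disjoint_sdiff
  · rintro ⟨S, W⟩ h
    simp only [Finset.mem_sigma, Finset.mem_powerset] at *
    rw [show (U \ W) \ (S \ W) = U \ S by
      ext x
      have := @h.2 x
      simp only [Finset.mem_sdiff]
      tauto]
    ring

lemma setConv_neg (a b : Finset V → R) : setConv (-a) b = -setConv a b := by
  funext U
  simp [setConv]

/-- The part of a set function that lives on the sets containing `m`. -/
def onMem (m : V) (a : Finset V → R) (U : Finset V) : R := if m ∈ U then a U else 0

/-- The part of a set function that lives on the sets avoiding `m`. -/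
def onNotMem (m : V) (a : Finset V → R) (U : Finset V) : R := if m ∈ U then 0 else a U

/-- If `m ∈ U`, then `m` lies in exactly one of `S` and `U \ S`. -/
lemma onMem_setConv (m : V) (a b : Finset V → R) :
    onMem m (setConv a b) =
      setConv (onMem m a) (onNotMem m b) + setConv (onNotMem m a) (onMem m b) := by
  funext U
  simp only [onMem, onNotMem, setConv, Pi.add_apply, ← Finset.sum_add_distrib]
  split_ifs with hm
  · refine Finset.sum_congr rfl fun S _ => ?_
    by_cases hS : m ∈ S <;> simp [hS, hm]
  · symm
    refine Finset.sum_eq_zero fun S hS => ?_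
    have : m ∉ S := fun h => hm (Finset.mem_powerset.1 hS h)
    simp [this, hm]

lemma onNotMem_setConv (m : V) (a b : Finset V → R) :
    onNotMem m (setConv a b) = setConv (onNotMem m a) (onNotMem m b) := by
  funext U
  simp only [onNotMem, setConv]
  split_ifs with hm
  · symm
    refine Finset.sum_eq_zero fun S _ => ?_
    by_cases hS : m ∈ S <;> simp [hS, hm]
  · refine Finset.sum_congr rfl fun S hS => ?_
    have : m ∉ S := fun h => hm (Finset.mem_powerset.1 hS h)
    simp [this, hm]

/-- The unit of the convolution. -/
def setDelta (U : Finset V) : R := if U = ∅ then 1 else 0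

lemma setConv_setDelta (a : Finset V → R) : setConv a setDelta = a := by
  funext U
  rw [setConv, Finset.sum_eq_single U]
  · simp [setDelta]
  · intro S hS hSU
    have : U \ S ≠ ∅ := fun h =>
      hSU (Finset.Subset.antisymm (Finset.mem_powerset.1 hS) (Finset.sdiff_eq_empty_iff_subset.1 h))
    simp [setDelta, this]
  · simp

/-- If `a` and `b` are inverse to each other, then `b' = -(a' b) b`, where `'` keeps the sets
containing `m`. -/
lemma setConv_onMem_of_inverse (m : V) {a b : Finset V → R} (hab : setConv a b = setDelta) :
    setConv (setConv (onMem m a) (onNotMem m b)) (onNotMem m b) = -onMem m b := by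
  have hδ : onMem m (setDelta : Finset V → R) = 0 := by
    funext U
    by_cases hU : U = ∅ <;> simp [onMem, setDelta, hU]
  have hδ' : onNotMem m (setDelta : Finset V → R) = setDelta := by
    funext U
    by_cases hU : U = ∅ <;> simp [onNotMem, setDelta, hU]
  -- The unit vanishes on sets containing `m`, so a' b'' = -(a'' b'). Multiplying by b'' and using
  -- a'' b'' = δ leaves -b'.
  have h1 := onMem_setConv m a b
  rw [hab, hδ, eq_comm, add_eq_zero_iff_eq_neg] at h1
  rw [h1, setConv_neg, setConv_comm (onNotMem m a), setConv_assoc, ← onNotMem_setConv, hab, hδ',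
    setConv_setDelta]

end Convolution

/-! ### Sources of acyclic orientations -/

section Sources

variable [Fintype V]

/-- No arc of `γ` ends in `v`. -/
def IsSource (γ : Digraph V) (v : V) : Prop := ∀ u, ¬ γ.Adj u v

/-- Walking backwards from `v` must stop: on a finite set, the transitive closure of an acyclic
relation is well-founded. -/
lemma IsAcyclic.exists_source {γ : Digraph V} (hγ : IsAcyclic γ) (v : V) :
    ∃ s, IsSource γ s ∧ Relation.ReflTransGen γ.Adj s v := by
  have : Std.Irrefl (Relation.TransGen γ.Adj) := ⟨hγ⟩
  have hwf : WellFounded (Relation.TransGen γ.Adj) := Finite.wellFounded_of_trans_of_irrefl _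
  induction v using hwf.induction with
  | _ v ih =>
    by_cases hv : IsSource γ v
    · exact ⟨v, hv, .refl⟩
    · simp only [IsSource, not_forall, not_not] at hv
      obtain ⟨u, hu⟩ := hv
      obtain ⟨s, hs, hsu⟩ := ih u (.single hu)
      exact ⟨s, hs, hsu.tail hu⟩

/-- Turns reachability from `m` into a condition on sources, which inclusion-exclusion can handle.
Every vertex is reachable from some source, and a source is reachable only from itself. Vertices
outside `U` are isolated, hence sources, and have to be ignored. -/
lemma sources_subset_singleton_iff {G : SimpleGraph V} {U : Finset V} {m : V} {γ : Digraph V}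
    (hγ : γ ∈ acyclicOrientations (graphOn G U)) :
    (∀ v ∈ U, IsSource γ v → v = m) ↔ ∀ v ∈ U, Relation.ReflTransGen γ.Adj m v := by
  rw [mem_acyclicOrientations] at hγ
  constructor
  · intro h v hv
    obtain ⟨s, hs, hsv⟩ := hγ.2.exists_source v
    have hsU : s ∈ U := by
      rcases hsv.cases_head with rfl | ⟨c, hc, -⟩
      · exact hv
      · exact hγ.1.mem_left hc
    exact h s hsU hs ▸ hsv
  · intro h v hv hs
    rcases (h v hv).cases_tail with h | ⟨c, -, hc⟩
    · exact h
    · exact absurd hc (hs c)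

variable [DecidableEq V]

open Classical in
/-- The signed indicator function of the independent sets. -/
noncomputable def indepSign (G : SimpleGraph V) (I : Finset V) : ℤ :=
  if ∀ a ∈ I, ∀ b ∈ I, ¬ G.Adj a b then (-1) ^ I.card else 0

/-- The number of acyclic orientations of the induced subgraph on `U`. -/
noncomputable def numAcyclic (G : SimpleGraph V) (U : Finset V) : ℤ := (acyclicOrientations (graphOn G U)).card

open Classical in
/-- The number of acyclic orientations of the induced subgraph on `U` in which all vertices are
reachable from `m`. -/
noncomputable def numRooted (G : SimpleGraph V) (m : V) (U : Finset V) : ℤ :=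
  ((acyclicOrientations (graphOn G U)).filter
    fun γ => ∀ v ∈ U, Relation.ReflTransGen γ.Adj m v).card

open Classical in
lemma card_arcless (G : SimpleGraph V) (I : Finset V) :
    ∑ γ ∈ acyclicOrientations (graphOn G I), (if ∀ a b, ¬ γ.Adj a b then (1 : ℤ) else 0) =
      if ∀ a ∈ I, ∀ b ∈ I, ¬ G.Adj a b then 1 else 0 := by
  split_ifs with hI
  · rw [Finset.sum_eq_single ⊥]
    · simp
    · intro γ hγ hne
      rw [mem_acyclicOrientations] at hγ
      refine absurd ?_ hne
      ext a b
      refine iff_of_false (fun h => ?_) (by simp)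
      exact hI a (hγ.1.mem_left h) b (hγ.1.mem_right h) ((hγ.1.1 a b).2 (Or.inl h)).1
    · intro h
      refine absurd (mem_acyclicOrientations.2 ⟨⟨fun a b => ?_, ?_⟩, ?_⟩) h
      · simp only [graphOn, Digraph.bot_adj, or_self, iff_false]
        exact fun h => hI a h.2.1 b h.2.2 h.1
      · simp
      · intro v hv
        obtain ⟨c, -, hc⟩ := Relation.TransGen.tail'_iff.1 hv
        exact hc
  · refine Finset.sum_eq_zero fun γ hγ => if_neg fun h => hI fun a ha b hb hab => ?_
    rw [mem_acyclicOrientations] at hγ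
    rcases (hγ.1.1 a b).1 ⟨hab, ha, hb⟩ with h' | h'
    · exact h _ _ h'
    · exact h _ _ h'

open Classical in
-- All vertices of `I` are sources exactly when no arc leaves `U \ I` and there are no arcs inside
-- `I`. Splitting along the closed set `U \ I` then leaves a free acyclic orientation there and an
-- arcless one on `I`, which exists only if `I` is independent.
lemma card_sources_superset (G : SimpleGraph V) {I U : Finset V} (hI : I ⊆ U) :
    indepSign G I * numAcyclic G (U \ I) = (-1) ^ I.card *
      ∑ γ ∈ acyclicOrientations (graphOn G U), if ∀ v ∈ I, IsSource γ v then 1 else 0 := by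
  have h := sum_closed_eq_mul G (Finset.sdiff_subset : U \ I ⊆ U) (fun _ => (1 : ℤ))
    (fun γ => if ∀ a b, ¬ γ.Adj a b then (1 : ℤ) else 0)
  rw [Finset.sdiff_sdiff_eq_self hI, card_arcless, Finset.sum_filter] at h
  have h2 : ∑ γ ∈ acyclicOrientations (graphOn G U), (if ∀ v ∈ I, IsSource γ v then (1 : ℤ) else 0)
      = numAcyclic G (U \ I) * if ∀ a ∈ I, ∀ b ∈ I, ¬ G.Adj a b then 1 else 0 := by
    rw [numAcyclic, Finset.cast_card, ← h]
    refine Finset.sum_congr rfl fun γ hγ => ?_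
    rw [mem_acyclicOrientations] at hγ
    rw [one_mul, ← ite_and]
    congr 1
    rw [eq_iff_iff]
    constructor
    · intro h
      refine ⟨fun a b hab _ => Finset.mem_sdiff.2 ⟨hγ.1.mem_right hab, fun hb => h b hb a hab⟩,
        fun a b hab => h b hab.2.2 a hab.1⟩
    · rintro ⟨h, h'⟩ v hv u huv
      by_cases hu : u ∈ I
      · exact h' u v ⟨huv, hu, hv⟩
      · exact (Finset.mem_sdiff.1 (h u v huv (Finset.mem_sdiff.2 ⟨hγ.1.mem_left huv, hu⟩))).2 hv
  rw [h2, indepSign]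
  split_ifs
  · ring
  · simp

open Classical in
-- Inclusion-exclusion: for fixed `γ`, the signs are summed over all sets of sources lying in `U \
-- X`, which gives zero unless there is no such source.
lemma sum_indepSign_mul_numAcyclic (G : SimpleGraph V) (X U : Finset V) :
    ∑ I ∈ (U \ X).powerset, indepSign G I * numAcyclic G (U \ I) =
      ((acyclicOrientations (graphOn G U)).filter
        fun γ => ∀ v ∈ U, IsSource γ v → v ∈ X).card := by
  have h1 : ∀ I ∈ (U \ X).powerset, indepSign G I * numAcyclic G (U \ I) =
      ∑ γ ∈ acyclicOrientations (graphOn G U),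
        if ∀ v ∈ I, IsSource γ v then (-1) ^ I.card else 0 := by
    intro I hI
    rw [card_sources_superset G ((Finset.mem_powerset.1 hI).trans Finset.sdiff_subset),
      Finset.mul_sum]
    simp
  rw [Finset.sum_congr rfl h1, Finset.sum_comm, Finset.cast_card, Finset.sum_filter]
  refine Finset.sum_congr rfl fun γ _ => ?_
  rw [← Finset.sum_filter]
  have h2 : (U \ X).powerset.filter (fun I => ∀ v ∈ I, IsSource γ v) =
      ((U \ X).filter (IsSource γ)).powerset := by
    ext I
    simp only [Finset.mem_filter, Finset.mem_powerset, Finset.subset_iff]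
    grind
  rw [h2, Finset.sum_powerset_neg_one_pow_card]
  congr 1
  rw [eq_iff_iff, Finset.filter_eq_empty_iff]
  simp only [Finset.mem_sdiff]
  grind

/-- The case `X = ∅`: an acyclic orientation on a nonempty `U` always has a source in `U`. -/
lemma setConv_numAcyclic_indepSign (G : SimpleGraph V) :
    setConv (numAcyclic G) (indepSign G) = setDelta := by
  classical
  funext U
  have h := sum_indepSign_mul_numAcyclic G ∅ U
  rw [Finset.sdiff_empty] at h
  rw [setConv_comm, setConv, h, setDelta]
  split_ifs with hU
  · subst hU
    have h3 := card_arcless G ∅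
    simp only [Finset.notMem_empty, false_implies, implies_true, if_true] at h3 ⊢
    rw [Finset.filter_true, Finset.cast_card]
    refine (Finset.sum_congr rfl fun γ hγ => ?_).trans h3
    rw [if_pos]
    intro a b hab
    exact absurd ((mem_acyclicOrientations.1 hγ).1.mem_left hab) (Finset.notMem_empty _)
  · rw [Nat.cast_eq_zero, Finset.card_eq_zero, Finset.filter_eq_empty_iff]
    intro γ hγ h
    rw [mem_acyclicOrientations] at hγ
    obtain ⟨v, hv⟩ := Finset.nonempty_iff_ne_empty.2 hU
    obtain ⟨s, hs, hsv⟩ := hγ.2.exists_source v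
    refine Finset.notMem_empty s (h s ?_ hs)
    rcases hsv.cases_head with rfl | ⟨c, hc, -⟩
    · exact hv
    · exact hγ.1.mem_left hc

/-- The case `X = {m}`: sets `I` avoiding `m` are those contained in `U \ {m}`, and having no source
in `U` other than `m` means being rooted at `m`. -/
lemma setConv_numAcyclic_onMem (G : SimpleGraph V) (m : V) :
    setConv (onMem m (numAcyclic G)) (onNotMem m (indepSign G)) = onMem m (numRooted G m) := by
  classical
  funext U
  rw [setConv_comm, setConv, onMem]
  split_ifs with hm
  · have h := sum_indepSign_mul_numAcyclic G {m} U
    rw [numRooted]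
    have h1 : (acyclicOrientations (graphOn G U)).filter
        (fun γ => ∀ v ∈ U, Relation.ReflTransGen γ.Adj m v) =
        (acyclicOrientations (graphOn G U)).filter
          (fun γ => ∀ v ∈ U, IsSource γ v → v ∈ ({m} : Finset V)) :=
      Finset.filter_congr fun γ hγ => by
        simpa using (sources_subset_singleton_iff hγ).symm
    rw [h1, ← h]
    symm
    refine Finset.sum_subset_zero_on_sdiff
      (Finset.powerset_mono.2 Finset.sdiff_subset) ?_ ?_
    · intro S hS
      obtain ⟨h2, h3⟩ := Finset.mem_sdiff.1 hS
      have : m ∈ S := by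
        by_contra hmS
        refine h3 (Finset.mem_powerset.2 fun x hx => Finset.mem_sdiff.2
          ⟨Finset.mem_powerset.1 h2 hx, ?_⟩)
        rw [Finset.mem_singleton]
        rintro rfl
        exact hmS hx
      simp [onNotMem, this]
    · intro S hS
      have : m ∉ S := fun h => by simpa using Finset.mem_powerset.1 hS h
      simp [onNotMem, onMem, this, hm]
  · refine Finset.sum_eq_zero fun S _ => ?_
    simp [onMem, hm]

/-- The key identity: deleting the vertices reachable from `m` recursively computes the signed
indicator function of the independent sets. -/
lemma sum_numRooted_mul_indepSign (G : SimpleGraph V) {m : V} {U : Finset V} (hm : m ∈ U) :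
    ∑ S ∈ U.powerset with m ∈ S, numRooted G m S * indepSign G (U \ S) = -indepSign G U := by
  have h := congrFun (setConv_onMem_of_inverse m (setConv_numAcyclic_indepSign G)) U
  rw [setConv_numAcyclic_onMem] at h
  simp only [setConv, Pi.neg_apply, onMem, hm, if_true] at h
  rw [← h, Finset.sum_filter]
  refine Finset.sum_congr rfl fun S _ => ?_
  by_cases hS : m ∈ S <;> simp [hS, onNotMem]

end Sources

/-! ### Weighted enumeration of source-components -/

section Components

variable {n : ℕ}

/-- The product of the weights of the next `k` sets constructed, given the union `C` of the sets
already constructed. -/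
noncomputable def componentWeight (W : Finset (Fin n) → ℤ) (γ : Digraph (Fin n)) :
    Finset (Fin n) → ℕ → ℤ
  | _, 0 => 1
  | C, k + 1 => W (nextComponent γ C) * componentWeight W γ (C ∪ nextComponent γ C) k

lemma componentWeight_covered (W : Finset (Fin n) → ℤ)
    (γ : Digraph (Fin n)) (j k : ℕ) :
    componentWeight W γ (covered γ j) k = ∏ i ∈ Finset.range k, W (sourceComponent γ (j + i)) := by
  induction k generalizing j with
  | zero => simp [componentWeight]
  | succ k ih =>
    rw [componentWeight, ← covered, ih, Finset.prod_range_succ', mul_comm]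
    simp only [sourceComponent, Nat.succ_eq_add_one, add_zero, add_assoc, add_comm 1]

lemma mem_reachable {γ : Digraph (Fin n)} {i j : Fin n} :
    j ∈ reachable γ i ↔ Relation.ReflTransGen γ.Adj i j := by
  simp [reachable]

/-- A path ending outside the closed set `C` never meets `C`, so deleting `C` does not change
reachability there. -/
lemma nextComponent_digraphOn {γ : Digraph (Fin n)} {C : Finset (Fin n)}
    (hC : IsClosedUnder γ C) : nextComponent (digraphOn γ Cᶜ) C = nextComponent γ C := by
  unfold nextComponent
  split_ifs with h
  · ext v
    simp only [Finset.mem_sdiff, mem_reachable]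
    refine and_congr_left fun hv => ⟨fun h => Relation.ReflTransGen.mono (fun a b h => h.1) _ _ h,
      fun h => ?_⟩
    induction h with
    | refl => exact .refl
    | tail _ hbc ih =>
      rename_i b c _
      have hb : b ∉ C := fun hb => hv (hC _ _ hbc hb)
      exact (ih hb).tail ⟨hbc, Finset.mem_compl.2 hb, Finset.mem_compl.2 hv⟩
  · rfl

lemma isClosedUnder_union_nextComponent {γ : Digraph (Fin n)} {C : Finset (Fin n)}
    (hC : IsClosedUnder γ C) : IsClosedUnder γ (C ∪ nextComponent γ C) := by
  intro a b hab ha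
  unfold nextComponent at *
  split_ifs at * with h
  · simp only [Finset.union_sdiff_self_eq_union, Finset.mem_union, mem_reachable] at *
    exact ha.imp (hC a b hab) fun h => h.tail hab
  · simp only [Finset.union_empty] at *
    exact hC a b hab ha

/-- The later components see only the arcs outside the part already removed. This makes the
remaining weight a function of the restriction to `U \ S`, as the product formula for gluing
requires. -/
lemma componentWeight_digraphOn (W : Finset (Fin n) → ℤ)
    {γ : Digraph (Fin n)} {C : Finset (Fin n)} (hC : IsClosedUnder γ C) (k : ℕ) :
    componentWeight W (digraphOn γ Cᶜ) C k = componentWeight W γ C k := by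
  induction k generalizing γ C with
  | zero => rfl
  | succ k ih =>
    rw [componentWeight, componentWeight, nextComponent_digraphOn hC]
    have h1 := isClosedUnder_union_nextComponent hC
    set C' := C ∪ nextComponent γ C
    have h2 : IsClosedUnder (digraphOn γ Cᶜ) C' := fun a b hab => h1 a b hab.1
    rw [← ih h1, ← ih h2]
    congr 2
    have h3 : C'ᶜ ⊆ Cᶜ := Finset.compl_subset_compl.2 Finset.subset_union_left
    ext a b
    have := @h3 a
    have := @h3 b
    simp only [digraphOn]
    tauto

/-- The vertices reachable from `m ∈ U` form the unique closed set `S ⊆ U` all of whose vertices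
are reachable from `m` inside `S`. -/
lemma eq_reachable_iff {S : Finset (Fin n)} {m : Fin n} {γ : Digraph (Fin n)}
    (hm : m ∈ S) :
    reachable γ m = S ↔ IsClosedUnder γ S ∧
      ∀ v ∈ S, Relation.ReflTransGen (digraphOn γ S).Adj m v := by
  constructor
  · rintro rfl
    refine ⟨fun a b hab ha => mem_reachable.2 ((mem_reachable.1 ha).tail hab), fun v hv => ?_⟩
    have hv := mem_reachable.1 hv
    induction hv with
    | refl => exact .refl
    | tail hb hbc ih =>
      exact (ih (mem_reachable.2 hb)).tail ⟨hbc, mem_reachable.2 hb, mem_reachable.2 (hb.tail hbc)⟩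
  · rintro ⟨hc, hS⟩
    ext v
    rw [mem_reachable]
    refine ⟨fun h => ?_, fun h => Relation.ReflTransGen.mono (fun a b h => h.1) _ _ (hS v h)⟩
    induction h with
    | refl => exact hm
    | tail _ hbc ih => exact hc _ _ hbc ih

lemma reachable_subset {G : SimpleGraph (Fin n)} {U : Finset (Fin n)} {m : Fin n} (hm : m ∈ U)
    {γ : Digraph (Fin n)} (hγ : γ ∈ acyclicOrientations (graphOn G U)) : reachable γ m ⊆ U := by
  intro v hv
  rcases (mem_reachable.1 hv).cases_tail with rfl | ⟨c, -, hc⟩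
  · exact hm
  · exact (mem_acyclicOrientations.1 hγ).1.mem_right hc

/-- The sum over the acyclic orientations on `U` of the products of weights of the components. -/
noncomputable def weightSum (G : SimpleGraph (Fin n)) (W : Finset (Fin n) → ℤ)
    (U : Finset (Fin n)) (k : ℕ) : ℤ :=
  ∑ γ ∈ acyclicOrientations (graphOn G U), componentWeight W γ Uᶜ k

lemma numAcyclic_empty (G : SimpleGraph (Fin n)) : numAcyclic G ∅ = 1 := by
  have h := congrFun (setConv_numAcyclic_indepSign G) ∅
  simpa [setConv, setDelta, indepSign] using h

/-- Once the vertices are used up, only empty sets follow; `W ∅ = 1` makes surplus steps harmless.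
-/
lemma weightSum_empty (G : SimpleGraph (Fin n)) (W : Finset (Fin n) → ℤ) (hW : W ∅ = 1) (k : ℕ) :
    weightSum G W ∅ k = 1 := by
  have h : ∀ γ, componentWeight W γ Finset.univ k = 1 := by
    intro γ
    induction k with
    | zero => rfl
    | succ k ih => simp [componentWeight, nextComponent, hW, ih]
  rw [weightSum, Finset.compl_empty, Finset.sum_congr rfl fun γ _ => h γ, ← Finset.cast_card]
  exact numAcyclic_empty G

/-- Splitting off the first component. -/
lemma weightSum_succ (G : SimpleGraph (Fin n))
    (W : Finset (Fin n) → ℤ) {U : Finset (Fin n)} (hU : U.Nonempty) (k : ℕ) :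
    weightSum G W U (k + 1) = ∑ S ∈ U.powerset with U.min' hU ∈ S,
      W S * numRooted G (U.min' hU) S * weightSum G W (U \ S) k := by
  classical
  set m := U.min' hU with hm
  have hmU : m ∈ U := U.min'_mem hU
  -- All arcs lie inside `U`, so nothing reachable from `m` is lost by removing `Uᶜ`.
  have hnext : ∀ γ ∈ acyclicOrientations (graphOn G U), nextComponent γ Uᶜ = reachable γ m := by
    intro γ hγ
    have h1 := reachable_subset hmU hγ
    simp only [nextComponent, compl_compl, hU, dif_pos, ← hm]
    rw [Finset.sdiff_eq_self_iff_disjoint]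
    exact Finset.disjoint_left.2 fun x hx hx' => Finset.mem_compl.1 hx' (h1 hx)
  have hmaps : ∀ γ ∈ acyclicOrientations (graphOn G U),
      reachable γ m ∈ U.powerset.filter (m ∈ ·) := fun γ hγ =>
    Finset.mem_filter.2 ⟨Finset.mem_powerset.2 (reachable_subset hmU hγ), mem_reachable.2 .refl⟩
  rw [weightSum, ← Finset.sum_fiberwise_of_maps_to hmaps]
  refine Finset.sum_congr rfl fun S hS => ?_
  obtain ⟨hSU, hmS⟩ := Finset.mem_filter.1 hS
  rw [Finset.mem_powerset] at hSU
  have h := sum_closed_eq_mul G hSU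
    (fun γ => if ∀ v ∈ S, Relation.ReflTransGen γ.Adj m v then (1 : ℤ) else 0)
    (fun γ => componentWeight W γ (U \ S)ᶜ k)
  have hcast : numRooted G m S = ∑ γ ∈ acyclicOrientations (graphOn G S),
      if ∀ v ∈ S, Relation.ReflTransGen γ.Adj m v then (1 : ℤ) else 0 := by
    rw [numRooted, Finset.cast_card, Finset.sum_filter]
    congr!
  rw [mul_assoc, hcast, weightSum, ← h, Finset.mul_sum, Finset.sum_filter, Finset.sum_filter]
  refine Finset.sum_congr rfl fun γ hγ => ?_
  have hiff := eq_reachable_iff (γ := γ) hmS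
  by_cases hr : reachable γ m = S
  · obtain ⟨h1, h2⟩ := hiff.1 hr
    rw [if_pos hr, if_pos h1, if_pos h2, componentWeight, hnext γ hγ, hr, one_mul]
    have hcompl : Uᶜ ∪ S = (U \ S)ᶜ := by
      ext x
      simp only [Finset.mem_union, Finset.mem_compl, Finset.mem_sdiff]
      tauto
    -- Vertices outside `U` carry no arcs, and no arc leaves `S`.
    have hclosed : IsClosedUnder γ (U \ S)ᶜ := by
      intro a b hab ha
      simp only [Finset.mem_compl, Finset.mem_sdiff, not_and, not_not] at *
      exact fun _ => h1 a b hab (ha ((mem_acyclicOrientations.1 hγ).1.mem_left hab))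
    rw [hcompl, ← componentWeight_digraphOn W hclosed, compl_compl]
  · rw [if_neg hr]
    split_ifs with h1 h2
    · exact absurd (hiff.2 ⟨h1, h2⟩) hr
    · simp
    · rfl

end Components

/-! ### Orientations and colorings -/

section Colorings

variable {n : ℕ} {α : Type*}

open Classical in
/-- The weight of a component `S` with respect to a coloring: `(-1)^(|S|-1)` if the coloring is
constant on `S`, and `0` otherwise; the empty set has weight `1`. -/
noncomputable def colorWeight (f : Fin n → α) (S : Finset (Fin n)) : ℤ :=
  if S = ∅ then 1 else if ∀ a ∈ S, ∀ b ∈ S, f a = f b then (-1) ^ (S.card + 1) else 0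

/-- The coloring `f` is proper on `U`. -/
def IsProperOn (G : SimpleGraph (Fin n)) (f : Fin n → α) (U : Finset (Fin n)) : Prop :=
  ∀ a ∈ U, ∀ b ∈ U, G.Adj a b → f a ≠ f b

open Classical in
lemma weightSum_colorWeight (G : SimpleGraph (Fin n)) (f : Fin n → α) (U : Finset (Fin n)) (k : ℕ)
    (hk : U.card ≤ k) :
    weightSum G (colorWeight f) U k = if IsProperOn G f U then 1 else 0 := by
  induction k generalizing U with
  | zero =>
    obtain rfl : U = ∅ := Finset.card_eq_zero.1 (Nat.le_zero.1 hk)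
    rw [weightSum_empty G _ (by simp [colorWeight]), if_pos (by simp [IsProperOn])]
  | succ k ih =>
    rcases U.eq_empty_or_nonempty with rfl | hU
    · rw [weightSum_empty G _ (by simp [colorWeight]), if_pos (by simp [IsProperOn])]
    rw [weightSum_succ G _ hU]
    set m := U.min' hU with hm
    have hmU : m ∈ U := U.min'_mem hU
    -- The color class of `m`: `f` is constant on a set `S ∋ m` only if `S ⊆ D`.
    set D := U.filter (fun v => f v = f m) with hD
    have hmD : m ∈ D := by simp [hD, hmU]
    have hDU : D ⊆ U := Finset.filter_subset _ _
    -- `U \ D` and `D \ S` share no color, so conflicts occur only within one of them. The sign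
    -- turns `indepSign` into a plain indicator.
    have hproper : ∀ S ⊆ D, (if IsProperOn G f (U \ S) then (1 : ℤ) else 0) =
        (if IsProperOn G f (U \ D) then 1 else 0) *
          ((-1) ^ (D \ S).card * indepSign G (D \ S)) := by
      intro S hS
      have : IsProperOn G f (U \ S) ↔
          IsProperOn G f (U \ D) ∧ ∀ a ∈ D \ S, ∀ b ∈ D \ S, ¬ G.Adj a b := by
        simp only [IsProperOn, Finset.subset_iff, hD, Finset.mem_sdiff, Finset.mem_filter] at *
        constructor
        · intro h
          refine ⟨fun a ha b hb => h a ?_ b ?_, fun a ha b hb hab => h a ?_ b ?_ hab ?_⟩ <;> grind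
        · rintro ⟨h1, h2⟩ a ha b hb hab hf
          by_cases hfa : f a = f m
          · exact h2 a (by grind) b (by grind) hab
          · exact h1 a (by grind) b (by grind) hab hf
      rw [indepSign]
      by_cases h1 : IsProperOn G f (U \ D) <;>
        by_cases h2 : ∀ a ∈ D \ S, ∀ b ∈ D \ S, ¬ G.Adj a b
      · rw [if_pos (this.2 ⟨h1, h2⟩), if_pos h1, if_pos h2]
        simp [← mul_pow]
      · rw [if_neg fun h => h2 (this.1 h).2, if_neg h2]
        simp
      · rw [if_neg fun h => h1 (this.1 h).1, if_neg h1, zero_mul]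
      · rw [if_neg fun h => h1 (this.1 h).1, if_neg h1, zero_mul]
    have h0 := hproper ∅ (Finset.empty_subset _)
    -- The signs (-1)^(|S|+1) and (-1)^|D \ S| combine to (-1)^(|D|+1), independent of `S`.
    have hsub : ∑ S ∈ U.powerset with m ∈ S,
        colorWeight f S * numRooted G m S * weightSum G (colorWeight f) (U \ S) k =
        ∑ S ∈ D.powerset with m ∈ S,
          (if IsProperOn G f (U \ D) then 1 else 0) * ((-1) ^ (D.card + 1)) *
            (numRooted G m S * indepSign G (D \ S)) := by
      symm
      refine Finset.sum_subset_zero_on_sdiff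
        (Finset.filter_subset_filter _ (Finset.powerset_mono.2 hDU)) ?_ ?_
      · intro S hS
        obtain ⟨h1, h2⟩ := Finset.mem_sdiff.1 hS
        obtain ⟨h3, h4⟩ := Finset.mem_filter.1 h1
        rw [colorWeight, if_neg (Finset.ne_empty_of_mem h4), if_neg, zero_mul, zero_mul]
        intro h
        refine h2 (Finset.mem_filter.2 ⟨Finset.mem_powerset.2 fun v hv => ?_, h4⟩)
        exact Finset.mem_filter.2 ⟨Finset.mem_powerset.1 h3 hv, h v hv m h4⟩
      · intro S hS
        obtain ⟨h1, h2⟩ := Finset.mem_filter.1 hS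
        rw [Finset.mem_powerset] at h1
        have hc : (U \ S).card ≤ k := by
          have : (U \ S).card < U.card := Finset.card_lt_card
            ⟨Finset.sdiff_subset, fun h => (Finset.mem_sdiff.1 (h hmU)).2 h2⟩
          omega
        have hconst : ∀ a ∈ S, ∀ b ∈ S, f a = f b := fun a ha b hb => by
          rw [(Finset.mem_filter.1 (h1 ha)).2, (Finset.mem_filter.1 (h1 hb)).2]
        rw [ih _ hc, hproper S h1, colorWeight, if_neg (Finset.ne_empty_of_mem h2), if_pos hconst,
          ← Finset.card_sdiff_add_card_eq_card h1]
        ring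
    -- The sum becomes (-1)^|D| `indepSign G D` times the indicator for `U \ D`, which is `hproper`
    -- at `S = ∅`.
    rw [hsub, ← Finset.mul_sum, sum_numRooted_mul_indepSign G hmD]
    rw [Finset.sdiff_empty, Finset.sdiff_empty] at h0
    rw [h0]
    ring

open Classical in
/-- For every coloring `f`, the signed number of acyclic orientations with `f` constant on each
source-component is `1` if `f` is proper and `0` otherwise. -/
lemma sum_prod_colorWeight (G : SimpleGraph (Fin n)) (f : Fin n → α) :
    ∑ γ ∈ acyclicOrientations G, ∏ i ∈ Finset.range n, colorWeight f (sourceComponent γ i) =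
      if ∀ a b, G.Adj a b → f a ≠ f b then 1 else 0 := by
  have h := weightSum_colorWeight G f Finset.univ n (by simp)
  have hG : graphOn G Finset.univ = G := by
    ext a b
    simp [graphOn]
  rw [weightSum, hG, Finset.compl_univ] at h
  simp only [IsProperOn, Finset.mem_univ, true_implies] at h
  rw [← h]
  refine Finset.sum_congr rfl fun γ _ => ?_
  have := componentWeight_covered (colorWeight f) γ 0 n
  simpa [covered] using this.symm

end Colorings

/-! ### Restriction to finitely many variables -/

section Restriction

variable {K : Type*} [CommRing K]

/-- A monomial of degree d involves at most d variables, which a permutation moves among the first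
d. -/
lemma ext_restrict {f g : SymFun K} (h : ∀ m, restrict K m f = restrict K m g) : f = g := by
  ext d
  exact coeff_eq_of_restrict_eq (h d.degree) le_rfl

lemma coeff_restrict (m : ℕ) (f : SymFun K) (d : Fin m →₀ ℕ) :
    MvPowerSeries.coeff d (restrict K m f) =
      MvPowerSeries.coeff (d.embDomain (firstVars m)) f.1 := rfl

/-- For `k = 0` the two sides differ: `p_0` is 1, while the sum would be `m`. -/
lemma restrict_powerSum (m : ℕ) {k : ℕ} (hk : k ≠ 0) :
    restrict K m (powerSum K k) = ∑ c, (MvPowerSeries.X c : MvPowerSeries (Fin m) K) ^ k := by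
  classical
  ext d
  rw [coeff_restrict, map_sum]
  simp only [MvPowerSeries.coeff_X_pow]
  change ite _ _ _ = _
  by_cases h : ∃ c, d = Finsupp.single c k
  · obtain ⟨c, rfl⟩ := h
    rw [if_pos ⟨firstVars m c, Finsupp.embDomain_single _ _ _⟩, Finset.sum_eq_single c]
    · simp
    · intro b _ hb
      rw [if_neg]
      intro h
      rw [Finsupp.single_left_inj hk] at h
      exact hb h.symm
    · simp
  · rw [if_neg, Finset.sum_eq_zero]
    · intro c _
      exact if_neg fun h' => h ⟨c, h'⟩
    · rintro ⟨i, hi⟩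
      obtain ⟨c, hc, -⟩ := Finsupp.single_of_embDomain_single d (firstVars m) i k hk hi
      exact h ⟨c, hc⟩

lemma powerSum_zero : powerSum K 0 = 1 := by
  classical
  ext d
  change ite _ _ _ = MvPowerSeries.coeff d (1 : MvPowerSeries ℕ+ K)
  rw [MvPowerSeries.coeff_one]
  simp

lemma elemSym_zero : elemSym K 0 = 1 := by
  classical
  ext d
  change ite _ _ _ = MvPowerSeries.coeff d (1 : MvPowerSeries ℕ+ K)
  rw [MvPowerSeries.coeff_one]
  congr 1
  rw [eq_iff_iff, Finsupp.degree_eq_zero_iff]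
  exact ⟨fun h => h.1, by rintro rfl; simp⟩

lemma completeSym_zero : completeSym K 0 = 1 := by
  classical
  ext d
  change ite _ _ _ = MvPowerSeries.coeff d (1 : MvPowerSeries ℕ+ K)
  rw [MvPowerSeries.coeff_one]
  congr 1
  rw [eq_iff_iff, Finsupp.degree_eq_zero_iff]

lemma prod_X {n m : ℕ} (f : Fin n → Fin m) :
    ∏ v, (MvPowerSeries.X (f v) : MvPowerSeries (Fin m) K) =
      MvPowerSeries.monomial (∑ v, Finsupp.single (f v) 1) 1 := by
  simp only [MvPowerSeries.X_def, MvPowerSeries.prod_monomial, Finset.prod_const_one]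

open Classical in
lemma restrict_chromaticSymFun {n : ℕ} (G : SimpleGraph (Fin n)) (m : ℕ) :
    restrict K m (chromaticSymFun K G) = ∑ f : Fin n → Fin m,
      if ∀ a b, G.Adj a b → f a ≠ f b then ∏ v, MvPowerSeries.X (f v) else 0 := by
  ext d
  rw [coeff_restrict, ← Finset.sum_filter, map_sum]
  simp only [prod_X, MvPowerSeries.coeff_monomial]
  rw [Finset.sum_boole, Finset.filter_filter]
  change ((Nat.card _ : ℕ) : K) = _
  congr 1
  have hemb : ∀ f : Fin n → Fin m, ∑ v, Finsupp.single (firstVars m (f v)) 1 =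
      (∑ v, Finsupp.single (f v) 1 : Fin m →₀ ℕ).embDomain (firstVars m) := by
    intro f
    simp [Finsupp.embDomain_eq_mapDomain, Finsupp.mapDomain_finsetSum, Finsupp.mapDomain_single]
  rw [← Nat.subtype_card (p := fun f : Fin n → Fin m => (∀ a b, G.Adj a b → f a ≠ f b) ∧
    d = ∑ v, Finsupp.single (f v) 1) _ (fun f => by simp)]
  symm
  refine Nat.card_eq_of_bijective (fun f => ⟨SimpleGraph.Coloring.mk (fun v => firstVars m (f.1 v))
    fun {a b} hab => (firstVars m).injective.ne (f.2.1 a b hab), ?_⟩) ⟨fun f g hfg => ?_, ?_⟩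
  · exact (hemb f.1).trans (congrArg _ f.2.2.symm)
  · apply Subtype.ext
    funext v
    have h := congrArg (fun F => F.1 v) hfg
    exact (firstVars m).injective h
  · rintro ⟨f, hf⟩
    -- The monomial of `f` involves only the first `m` variables, so `f` uses only those colors.
    have hr : ∀ v, f v ∈ Set.range (firstVars m) := by
      intro v
      by_contra hv
      have h0 := Finsupp.embDomain_of_notMem_range (firstVars m) d _ hv
      rw [← hf, Finsupp.finsetSum_apply, Finset.sum_eq_zero_iff] at h0
      simpa using h0 v (Finset.mem_univ v)
    choose g hg using hr
    refine ⟨⟨g, fun a b hab h => f.valid hab ?_, ?_⟩, ?_⟩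
    · rw [← hg, ← hg, h]
    · apply Finsupp.embDomain_injective (firstVars m)
      rw [← hemb, ← hf]
      simp only [hg]
    · apply Subtype.ext
      apply DFunLike.ext
      intro v
      exact hg v

end Restriction

/-! ### The power sum expansion of the chromatic symmetric function -/

section PowerSums

open Classical in
/-- A product of power sums of the fibre sizes of a map `c` is the sum over the colorings that
factor through `c`. -/
lemma prod_powerSum_fibers {V ι α R : Type*} [Fintype V] [DecidableEq V] [Fintype ι]
    [DecidableEq ι] [Fintype α] [CommRing R] (c : V → ι) (y : α → R) :
    ∏ i, (if (Finset.univ.filter (c · = i)).card = 0 then 1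
        else ∑ a, y a ^ (Finset.univ.filter (c · = i)).card) =
      ∑ f : V → α, if ∀ u v, c u = c v → f u = f v then ∏ v, y (f v) else 0 := by
  -- Empty fibres contribute 1. Dropping them makes the choices in the expanded product correspond
  -- exactly to the colorings factoring through `c`.
  have h1 : ∏ i, (if (Finset.univ.filter (c · = i)).card = 0 then 1
        else ∑ a, y a ^ (Finset.univ.filter (c · = i)).card) =
      ∏ i : Set.range c, ∑ a, y a ^ (Finset.univ.filter (c · = i)).card := by
    have h2 : ∀ i : Set.range c, (Finset.univ.filter (c · = (i : ι))).card ≠ 0 := by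
      rintro ⟨_, v, rfl⟩
      exact Finset.card_ne_zero_of_mem (Finset.mem_filter.2 ⟨Finset.mem_univ v, rfl⟩)
    rw [← Finset.prod_subtype (Finset.univ.filter (· ∈ Set.range c)) (by simp)
      (fun i => ∑ a, y a ^ (Finset.univ.filter (c · = i)).card), Finset.prod_filter]
    refine Finset.prod_congr rfl fun i _ => ?_
    by_cases hi : i ∈ Set.range c
    · rw [if_pos hi, if_neg (h2 ⟨i, hi⟩)]
    · rw [if_neg hi, if_pos]
      rw [Finset.card_eq_zero, Finset.filter_eq_empty_iff]
      exact fun v _ hv => hi ⟨v, hv⟩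
  rw [h1, Fintype.prod_sum, ← Finset.sum_filter]
  refine Finset.sum_bij' (fun g _ v => g ⟨c v, v, rfl⟩) (fun f _ i => f i.2.choose) ?_ ?_ ?_ ?_ ?_
  · intro g _
    refine Finset.mem_filter.2 ⟨Finset.mem_univ _, fun u v huv => ?_⟩
    simp only [huv]
  · simp
  · intro g _
    funext i
    have h := i.2.choose_spec
    simp only [h]
  · intro f hf
    funext v
    exact (Finset.mem_filter.1 hf).2 _ _ (Set.mem_range_self v).choose_spec
  · intro g _
    rw [← Finset.prod_fiberwise Finset.univ (fun v => (⟨c v, v, rfl⟩ : Set.range c))]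
    refine Finset.prod_congr rfl fun i _ => ?_
    rw [← Finset.prod_const]
    refine Finset.prod_congr ?_ ?_
    · ext v
      simp [Subtype.ext_iff]
    · intro v hv
      rw [← (Finset.mem_filter.1 hv).2]

variable {n : ℕ}

lemma mem_covered {γ : Digraph (Fin n)} {k : ℕ} {v : Fin n} :
    v ∈ covered γ k ↔ ∃ i < k, v ∈ sourceComponent γ i := by
  induction k with
  | zero => simp [covered]
  | succ k ih =>
    rw [covered, Finset.mem_union, ih, ← sourceComponent]
    simp only [Nat.lt_succ_iff_lt_or_eq, or_and_right, exists_or, exists_eq_left]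

lemma disjoint_covered_sourceComponent (γ : Digraph (Fin n)) (k : ℕ) :
    Disjoint (covered γ k) (sourceComponent γ k) := by
  rw [sourceComponent, nextComponent]
  split_ifs
  · exact Finset.disjoint_sdiff
  · exact Finset.disjoint_empty_right _

lemma sourceComponent_index_unique {γ : Digraph (Fin n)} {i j : ℕ} {v : Fin n}
    (hi : v ∈ sourceComponent γ i) (hj : v ∈ sourceComponent γ j) : i = j := by
  rcases lt_trichotomy i j with h | h | h
  · exact absurd hj (Finset.disjoint_left.1 (disjoint_covered_sourceComponent γ j)
      (mem_covered.2 ⟨i, h, hi⟩))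
  · exact h
  · exact absurd hi (Finset.disjoint_left.1 (disjoint_covered_sourceComponent γ i)
      (mem_covered.2 ⟨j, h, hj⟩))

/-- Every vertex lies in exactly one source-component. -/
lemma exists_componentIndex (γ : Digraph (Fin n)) :
    ∃ c : Fin n → Fin n, ∀ v (i : Fin n), v ∈ sourceComponent γ i ↔ c v = i := by
  have h : ∀ v, ∃ i : Fin n, v ∈ sourceComponent γ i := by
    intro v
    have hv : v ∈ covered γ n := by simp [covered_eq_univ_of_le γ le_rfl]
    obtain ⟨i, hi, h⟩ := mem_covered.1 hv
    exact ⟨⟨i, hi⟩, h⟩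
  choose c hc using h
  exact ⟨c, fun v i => ⟨fun h => Fin.ext (sourceComponent_index_unique (hc v) h),
    fun h => h ▸ hc v⟩⟩

/-- The sign `(-1)^(k-1)` of a part `k`; the part `0` has sign `1`. -/
def partSign (k : ℕ) : ℤ := if k = 0 then 1 else (-1) ^ (k + 1)

open Classical in
lemma colorWeight_eq {α : Type*} (f : Fin n → α) (S : Finset (Fin n)) :
    colorWeight f S = partSign S.card * if ∀ a ∈ S, ∀ b ∈ S, f a = f b then 1 else 0 := by
  rw [colorWeight, partSign]
  rcases S.eq_empty_or_nonempty with rfl | hS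
  · simp
  · rw [if_neg hS.ne_empty, if_neg (Finset.card_ne_zero.2 hS)]
    simp

variable {K : Type*} [CommRing K]

open Classical in
lemma prod_colorWeight {α : Type*} {γ : Digraph (Fin n)} {c : Fin n → Fin n}
    (hc : ∀ v (i : Fin n), v ∈ sourceComponent γ i ↔ c v = i) (f : Fin n → α) :
    ∏ i ∈ Finset.range n, colorWeight f (sourceComponent γ i) =
      (∏ i ∈ Finset.range n, partSign (sourceComponent γ i).card) *
        if ∀ u v, c u = c v → f u = f v then 1 else 0 := by
  simp only [colorWeight_eq, Finset.prod_mul_distrib]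
  congr 1
  rw [Finset.prod_ite_zero, Finset.prod_const_one]
  congr 1
  rw [eq_iff_iff]
  constructor
  · intro h u v huv
    exact h (c u) (Finset.mem_range.2 (c u).2) u ((hc u _).2 rfl) v ((hc v _).2 huv.symm)
  · intro h i hi a ha b hb
    rw [Finset.mem_range] at hi
    exact h a b (((hc a ⟨i, hi⟩).1 ha).trans ((hc b ⟨i, hi⟩).1 hb).symm)

lemma restrict_prod_powerSum (γ : Digraph (Fin n)) (m : ℕ) :
    restrict K m (∏ i ∈ Finset.range n, ((partSign (sourceComponent γ i).card : ℤ) : SymFun K) *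
        powerSum K (sourceComponent γ i).card) =
      ∑ f : Fin n → Fin m, ((∏ i ∈ Finset.range n, colorWeight f (sourceComponent γ i) : ℤ) :
        MvPowerSeries (Fin m) K) * ∏ v, MvPowerSeries.X (f v) := by
  classical
  obtain ⟨c, hc⟩ := exists_componentIndex γ
  have hS : ∀ i : Fin n, sourceComponent γ i = Finset.univ.filter (c · = i) := by
    intro i
    ext v
    rw [hc, Finset.mem_filter_univ]
  have hq : ∀ k, restrict K m (powerSum K k) = if k = 0 then 1 else
      ∑ a, (MvPowerSeries.X a : MvPowerSeries (Fin m) K) ^ k := by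
    intro k
    split_ifs with hk
    · rw [hk, powerSum_zero, map_one]
    · exact restrict_powerSum m hk
  have hp : ∏ i ∈ Finset.range n, restrict K m (powerSum K (sourceComponent γ i).card) =
      ∑ f : Fin n → Fin m, if ∀ u v, c u = c v → f u = f v then
        ∏ v, (MvPowerSeries.X (f v) : MvPowerSeries (Fin m) K) else 0 := by
    refine Eq.trans ?_ ((prod_powerSum_fibers c fun a => MvPowerSeries.X a).trans
      (Finset.sum_congr rfl fun f _ => by congr))
    rw [Finset.prod_range]
    refine Finset.prod_congr rfl fun i _ => ?_
    rw [hq, hS]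
  have hs : restrict K m (∏ i ∈ Finset.range n, ((partSign (sourceComponent γ i).card : ℤ) :
      SymFun K)) = ((∏ i ∈ Finset.range n, partSign (sourceComponent γ i).card : ℤ) :
        MvPowerSeries (Fin m) K) := by
    rw [← Int.cast_prod, map_intCast]
  rw [Finset.prod_mul_distrib, map_mul, hs, map_prod (restrict K m), hp, Finset.mul_sum]
  refine Finset.sum_congr rfl fun f _ => ?_
  rw [prod_colorWeight hc, Int.cast_mul, mul_assoc]
  congr 1
  split_ifs <;> simp

/-- In finitely many variables, exchanging the sums over `γ` and over colorings makes the
coefficient attached to each coloring its signed count, which is the indicator of properness. -/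
lemma chromaticSymFun_eq_sum_prod (G : SimpleGraph (Fin n)) :
    chromaticSymFun K G = ∑ γ ∈ acyclicOrientations G, ∏ i ∈ Finset.range n,
      ((partSign (sourceComponent γ i).card : ℤ) : SymFun K) *
        powerSum K (sourceComponent γ i).card := by
  classical
  refine ext_restrict fun m => ?_
  rw [restrict_chromaticSymFun, map_sum]
  simp only [restrict_prod_powerSum]
  rw [Finset.sum_comm]
  refine Finset.sum_congr rfl fun f _ => ?_
  rw [← Finset.sum_mul, ← Int.cast_sum, sum_prod_colorWeight]
  split_ifs <;> simp

lemma prod_parts_ofSums {R : Type*} [CommMonoid R] (l : Multiset ℕ) (hl : l.sum = n) (p : ℕ → R)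
    (hp : p 0 = 1) : ((Nat.Partition.ofSums n l hl).parts.map p).prod = (l.map p).prod := by
  change ((l.filter (· ≠ 0)).map p).prod = _
  clear hl
  induction l using Multiset.induction with
  | empty => simp
  | cons a l ih =>
    by_cases ha : a = 0
    · simp [ha, hp, ih]
    · simp [ha, ih]

/-- A nonzero part k contributes (-1)^(k+1), so the exponents add up to `n` plus the number of
nonzero parts. -/
lemma prod_map_partSign (l : Multiset ℕ) (hl : l.sum = n) :
    (l.map partSign).prod = (-1) ^ n * (-1) ^ (Nat.Partition.ofSums n l hl).parts.card := by
  change _ = (-1) ^ n * (-1) ^ (l.filter (· ≠ 0)).card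
  subst hl
  induction l using Multiset.induction with
  | empty => simp
  | cons a l ih =>
    by_cases ha : a = 0
    · simp [ha, partSign, ih]
    · simp [ha, partSign, ih]
      ring

lemma prod_sourceComponent {R : Type*} [CommMonoid R] (γ : Digraph (Fin n)) (p : ℕ → R)
    (hp : p 0 = 1) : ∏ i ∈ Finset.range n, p (sourceComponent γ i).card =
      ((sourcePartition γ).parts.map p).prod := by
  rw [sourcePartition, prod_parts_ofSums _ _ _ hp, Multiset.map_map]
  rfl

lemma partSign_mul_eq (γ : Digraph (Fin n)) :
    ∏ i ∈ Finset.range n, partSign (sourceComponent γ i).card =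
      (-1) ^ n * (-1) ^ (sourcePartition γ).parts.card := by
  rw [sourcePartition, ← prod_map_partSign, Multiset.map_map]
  rfl

/-- The power sum expansion of the chromatic symmetric function. -/
lemma chromaticSymFun_eq_powerSum (G : SimpleGraph (Fin n)) :
    chromaticSymFun K G = (-1) ^ n * ∑ γ ∈ acyclicOrientations G,
      (-1) ^ (sourcePartition γ).parts.card * powerSumPart K (sourcePartition γ) := by
  rw [chromaticSymFun_eq_sum_prod, Finset.mul_sum]
  refine Finset.sum_congr rfl fun γ _ => ?_
  rw [Finset.prod_mul_distrib, prod_sourceComponent γ _ powerSum_zero, ← Int.cast_prod,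
    partSign_mul_eq, powerSumPart, ← mul_assoc]
  push_cast
  rfl

end PowerSums

/-! ### The duality map on power sums -/

section Duality

variable {K : Type*} [CommRing K]

lemma neg_one_pow_mul_self {R : Type*} [CommRing R] (k : ℕ) : (-1 : R) ^ k * (-1) ^ k = 1 := by
  rw [← mul_pow, neg_one_mul, neg_neg, one_pow]

open Finset in
-- Newton's identity, lifted from finitely many variables.
lemma mul_elemSym_eq_sum (k : ℕ) :
    (k : SymFun K) * elemSym K k = (-1) ^ (k + 1) *
      ∑ a ∈ antidiagonal k with a.1 < k, (-1) ^ a.1 * elemSym K a.1 * powerSum K a.2 := by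
  refine ext_restrict fun m => ?_
  have h := congrArg (MvPolynomial.coeToMvPowerSeries.ringHom (R := K))
    (MvPolynomial.mul_esymm_eq_sum (Fin m) K k)
  simp only [map_mul, map_sum, map_pow, map_neg, map_one, map_natCast, restrict_elemSym] at h ⊢
  refine h.trans ?_
  congr 1
  refine Finset.sum_congr rfl fun a ha => ?_
  obtain ⟨h1, h2⟩ := Finset.mem_filter.1 ha
  rw [Finset.HasAntidiagonal.mem_antidiagonal] at h1
  rw [restrict_powerSum m (by omega)]
  simp [MvPolynomial.psum]

open Finset in
-- At a monomial of exponent d and degree `k`, the right side counts pairs (c, j) with 1 ≤ j ≤ d(c),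
-- and there are ∑ d(c) = k of them.
lemma mul_completeSym_eq_sum (k : ℕ) :
    (k : SymFun K) * completeSym K k =
      ∑ a ∈ antidiagonal k with a.1 < k, completeSym K a.1 * powerSum K a.2 := by
  classical
  refine ext_restrict fun m => ?_
  have hcoeff : ∀ (j : ℕ) (d : Fin m →₀ ℕ), MvPowerSeries.coeff d (restrict K m (completeSym K j)) =
      if d.degree = j then 1 else 0 := by
    intro j d
    rw [coeff_restrict]
    change ite _ _ _ = _
    rw [Finsupp.embDomain_eq_mapDomain, Finsupp.degree_mapDomain]
  have hterm : ∀ (d : Fin m →₀ ℕ), ∀ a ∈ (antidiagonal k).filter (fun a => a.1 < k),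
      MvPowerSeries.coeff d (restrict K m (completeSym K a.1) * restrict K m (powerSum K a.2)) =
        ∑ c : Fin m, if a.2 ≤ d c ∧ d.degree = k then (1 : K) else 0 := by
    intro d a ha
    obtain ⟨h1, h2⟩ := Finset.mem_filter.1 ha
    rw [Finset.HasAntidiagonal.mem_antidiagonal] at h1
    rw [restrict_powerSum m (by omega), Finset.mul_sum, map_sum]
    refine Finset.sum_congr rfl fun c _ => ?_
    rw [MvPowerSeries.X_pow_eq, MvPowerSeries.coeff_mul_monomial, hcoeff, mul_one, ite_and]
    simp only [Finsupp.single_le_iff]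
    by_cases h3 : a.2 ≤ d c
    · have h4 := congrArg Finsupp.degree (tsub_add_cancel_of_le (Finsupp.single_le_iff.2 h3))
      rw [map_add, Finsupp.degree_single] at h4
      rw [if_pos h3, if_pos h3]
      congr 1
      rw [eq_iff_iff]
      omega
    · rw [if_neg h3, if_neg h3]
  ext d
  have hcount : ∀ c : Fin m, d.degree = k →
      ∑ a ∈ antidiagonal k with a.1 < k, (if a.2 ≤ d c ∧ d.degree = k then (1 : K) else 0) =
        d c := by
    intro c hd
    have hle : d c ≤ k := hd ▸ Finsupp.le_degree c d
    rw [Finset.sum_boole, Finset.filter_filter]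
    congr 1
    -- On the antidiagonal, `a.1 < k` says that `a.2 ≥ 1`.
    refine Eq.trans (b := (Finset.Icc 1 (d c)).card) ?_ (by simp)
    refine Finset.card_nbij' (fun a => a.2) (fun b => (k - b, b)) ?_ ?_ ?_ ?_
    · intro a ha
      simp only [Finset.coe_filter, Set.mem_ofPred_eq, Finset.HasAntidiagonal.mem_antidiagonal] at ha
      simp only [Finset.coe_Icc, Set.mem_Icc]
      omega
    · intro b hb
      simp only [Finset.coe_filter, Set.mem_ofPred_eq, Finset.HasAntidiagonal.mem_antidiagonal]
      simp only [Finset.coe_Icc, Set.mem_Icc] at hb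
      omega
    · intro a ha
      simp only [Finset.coe_filter, Set.mem_ofPred_eq, Finset.HasAntidiagonal.mem_antidiagonal] at ha
      exact Prod.ext (by simp only; omega) rfl
    · intro b _
      rfl
  rw [map_mul, map_natCast, map_sum, map_sum]
  simp only [map_mul]
  rw [Finset.sum_congr rfl (hterm d), Finset.sum_comm,
    ← map_natCast (MvPowerSeries.C (σ := Fin m) (R := K)), MvPowerSeries.coeff_C_mul, hcoeff]
  split_ifs with hd
  · rw [Finset.sum_congr rfl fun c _ => hcount c hd, mul_one, ← hd, Finsupp.degree_eq_sum,
      Nat.cast_sum]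
  · simp [hd]

lemma omega_elemSym (k : ℕ) : omega K (elemSym K k) = completeSym K k := by
  rcases k.eq_zero_or_pos with rfl | hk
  · rw [elemSym_zero, completeSym_zero, map_one]
  · exact (eq_omega_iff (omega K)).1 rfl k hk

/-- Applying ω to Newton's identity for the e_k gives a second recursion for k h_k. By induction it
agrees term by term with the direct one except at `(0, k)`, where the coefficient of ω(p_k) is the
sign (-1)^(k+1). -/
lemma omega_powerSum (k : ℕ) : omega K (powerSum K k) = (partSign k : SymFun K) * powerSum K k := by
  induction k using Nat.strong_induction_on with
  | _ k ih =>
    rcases k.eq_zero_or_pos with rfl | hk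
    · simp [powerSum_zero, partSign]
    have h1 := congrArg (omega K) (mul_elemSym_eq_sum (K := K) k)
    simp only [map_mul, map_sum, map_pow, map_neg, map_one, map_natCast, omega_elemSym] at h1
    rw [mul_completeSym_eq_sum, Finset.mul_sum, ← sub_eq_zero, ← Finset.sum_sub_distrib,
      Finset.sum_eq_single (0, k)] at h1
    · rw [partSign, if_neg hk.ne']
      simp only [completeSym_zero, pow_zero, one_mul, sub_eq_zero] at h1
      have hs : (-1 : SymFun K) ^ (k + 1) * (-1) ^ (k + 1) = 1 :=
        neg_one_pow_mul_self (k + 1)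
      push_cast
      linear_combination (-(-1 : SymFun K) ^ (k + 1)) * h1 - omega K (powerSum K k) * hs
    · rintro ⟨i, j⟩ ha hne
      obtain ⟨h2, h3⟩ := Finset.mem_filter.1 ha
      rw [Finset.HasAntidiagonal.mem_antidiagonal] at h2
      simp only at h2 h3 ⊢
      have hi : i ≠ 0 := fun hi => hne (by simp [hi, ← h2])
      rw [ih j (by omega), partSign, if_neg (by omega), ← h2]
      have : ((-1 : SymFun K) ^ (i + j + 1)) * ((-1) ^ i * (-1) ^ (j + 1)) = 1 := by
        refine Eq.trans ?_ (neg_one_pow_mul_self (i + j + 1))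
        ring
      push_cast
      linear_combination (-(completeSym K i * powerSum K j)) * this
    · intro h
      exact absurd (Finset.mem_filter.2 ⟨Finset.HasAntidiagonal.mem_antidiagonal.2 (zero_add k), hk⟩) h

/-- Each component carries its sign once from the expansion and once from ω, and the two cancel. -/
lemma omega_chromaticSymFun {n : ℕ} (G : SimpleGraph (Fin n)) :
    omega K (chromaticSymFun K G) =
      ∑ γ ∈ acyclicOrientations G, powerSumPart K (sourcePartition γ) := by
  rw [chromaticSymFun_eq_sum_prod, map_sum]
  refine Finset.sum_congr rfl fun γ _ => ?_
  have hsign : ∀ k, (partSign k : SymFun K) * (partSign k : SymFun K) = 1 := by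
    intro k
    rw [← Int.cast_mul, partSign]
    split_ifs <;> simp [← mul_pow]
  rw [map_prod, powerSumPart, ← prod_sourceComponent γ _ powerSum_zero]
  refine Finset.prod_congr rfl fun i _ => ?_
  rw [map_mul, map_intCast, omega_powerSum, ← mul_assoc, hsign, one_mul]

end Duality
end ChromSym

theorem mainTheorem6 (K : Type*) [Field K] [CharZero K] (n : ℕ) (G : SimpleGraph (Fin n)) :
    ChromSym.chromaticSymFun K G =
        (-1) ^ n * ∑ γ ∈ ChromSym.acyclicOrientations G,
          (-1) ^ (ChromSym.sourcePartition γ).parts.card *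
            ChromSym.powerSumPart K (ChromSym.sourcePartition γ) ∧
      ChromSym.omega K (ChromSym.chromaticSymFun K G) =
        ∑ γ ∈ ChromSym.acyclicOrientations G,
          ChromSym.powerSumPart K (ChromSym.sourcePartition γ) :=
  ⟨ChromSym.chromaticSymFun_eq_powerSum G, ChromSym.omega_chromaticSymFun G⟩
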